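/- Let $K$ be a field that is complete with respect to a nontrivial discrete valuation, with residue field $k$ of characteristic $p>0$. Fix an algebraic closure $\overline K$, let $\ell\ge 2$ be an integer with $p\mid \ell$, and let $c\in\overline K$ be such that $f(z)=z^\ell-c$ is separable (equivalently, $\operatorname{char}K=0$ and $c\neq 0$). Let $v$ be the unique extension of the valuation to $\overline K$, normalized by $v(p)=1$. For $\alpha\in K$ let $K_n=K(\{\beta\in\overline K: f^n(\beta)=\alpha\})$, where $f^n$ is the $n$-th iterate, and let $K_\infty=\bigcup_{n\ge 0}K_n$. Set $\nu_\infty=-\frac{\ell}{\ell-1}v(\ell)$. For a finite extension $F/K$ let $e(F/K)=[v(F^\times):v(K^\times)]$. An algebraic extension $E/K$ is called finitely ramified if $e(F/K)$ is bounded as $F$ runs over the finite subextensions of $E/K$, and infinitely wildly ramified if for every $m$ some finite subextension $F$ has $p^m\mid e(F/K)$. 1. If $v(c)<\nu_\infty$, then $K_\infty/K$ is a finite extension. 2. If $v(c)=\nu_\infty$, then $K_\infty/K$ is finitely ramified if and only if $\ell=p$ and $\alpha$ lies in the closed unit disk $\{z: v(z-b)\ge 0\}$ centered at some fixed point $b\in\overline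 K$ of $f$. Moreover $K_\infty/K$ is an infinite extension if $k$ is finite (that is, if $K$ is a local field), and also, for arbitrary $k$, whenever it is not the case that $\ell=p$ and $\alpha$ lies in such a disk. 3. If $v(c)>\nu_\infty$, then $K_\infty/K$ is infinitely wildly ramified. -/

import Mathlib

open Polynomial

noncomputable section

namespace Arboreal

section Base

variable (K : Type*) [NontriviallyNormedField K] [IsUltrametricDist K]

/-- The ring of integers `{x ∈ K : |x| ≤ 1}` of a non-archimedean field. -/
abbrev RingOfIntegers : ValuationSubring K :=
  (NormedField.valuation (K := K)).valuationSubring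

/-- The residue field of `K`. -/
abbrev ResidueField : Type _ := IsLocalRing.ResidueField (RingOfIntegers K)

end Base

section Extension

variable {K : Type*} [NontriviallyNormedField K]

/-- The additive valuation on the algebraic closure of `K`, normalized by `v p = 1`:
`v x = log |x| / log |p|` for `x ≠ 0`, and `v 0 = ∞`. Here `|x|` is the spectral norm, which for
complete `K` is the unique absolute value on the algebraic closure extending that of `K`. -/
def v (p : ℕ) (x : AlgebraicClosure K) : EReal :=
  open Classical in
  if x = 0 then ⊤
  else ((Real.log (spectralNorm K (AlgebraicClosure K) x) / Real.log ‖(p : K)‖ : ℝ) : EReal)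

/-- The cutoff value `ν_∞ = - (ℓ / (ℓ - 1)) v(ℓ)`. -/
def nuInfty (K : Type*) [NontriviallyNormedField K] (p l : ℕ) : EReal :=
  ((-((l : ℝ) / ((l : ℝ) - 1)) : ℝ) : EReal) * v p (l : AlgebraicClosure K)

/-- The unicritical polynomial `z ^ ℓ - c`. -/
def unicritical (l : ℕ) (c : AlgebraicClosure K) : (AlgebraicClosure K)[X] :=
  X ^ l - C c

/-- The set `f^{-n}(α)` of solutions of `f^n(z) = α` in the algebraic closure. -/
def preimages (f : (AlgebraicClosure K)[X]) (a : K) (n : ℕ) : Set (AlgebraicClosure K) :=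
  {x | (fun z => f.eval z)^[n] x = algebraMap K (AlgebraicClosure K) a}

/-- The field `K_n = K(f^{-n}(α))`. -/
def level (f : (AlgebraicClosure K)[X]) (a : K) (n : ℕ) :
    IntermediateField K (AlgebraicClosure K) :=
  IntermediateField.adjoin K (preimages f a n)

/-- The field `K_∞` generated by all the `K_n`. -/
def levelInfty (f : (AlgebraicClosure K)[X]) (a : K) :
    IntermediateField K (AlgebraicClosure K) :=
  ⨆ n, level f a n

/-- `α` lies in the closed unit disk `{z : v (z - b) ≥ 0}` around some fixed point `b` of `f`. -/
def NearFixedPoint (p : ℕ) (f : (AlgebraicClosure K)[X]) (a : K) : Prop :=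
  ∃ b : AlgebraicClosure K, f.eval b = b ∧ 0 ≤ v p (algebraMap K (AlgebraicClosure K) a - b)

end Extension

section Ramification

variable {K : Type*} [NontriviallyNormedField K] [IsUltrametricDist K] [CompleteSpace K]

/-- The extended absolute value on the algebraic closure, as a multiplicative map. -/
def absHom (K : Type*) [NontriviallyNormedField K] [IsUltrametricDist K] [CompleteSpace K] :
    AlgebraicClosure K →* ℝ where
  toFun := spectralNorm K (AlgebraicClosure K)
  map_one' := spectralNorm_one
  map_mul' := spectralAlgNorm_mul

/-- The (multiplicative) value group `|Eˣ|` of an intermediate field `E`. -/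
def valueGroup (E : IntermediateField K (AlgebraicClosure K)) : Subgroup ℝˣ :=
  (Units.map ((absHom K).comp (algebraMap E (AlgebraicClosure K)).toMonoidHom)).range

/-- The ramification index `e(F/K) = [|Fˣ| : |Kˣ|]`; it is finite (and nonzero) when `F/K` is
finite, the only case in which it is used. -/
def ramificationIndex (F : IntermediateField K (AlgebraicClosure K)) : ℕ :=
  (valueGroup (⊥ : IntermediateField K (AlgebraicClosure K))).relIndex (valueGroup F)

/-- `E/K` is finitely ramified: the ramification indices of the finite subextensions of `E/K`
are bounded. -/
def IsFinitelyRamified (E : IntermediateField K (AlgebraicClosure K)) : Prop :=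
  ∃ B : ℕ, ∀ F : IntermediateField K (AlgebraicClosure K), F ≤ E → FiniteDimensional K F →
    ramificationIndex F ≤ B

/-- `E/K` is infinitely wildly ramified: arbitrarily high powers of the residue characteristic
`p` divide the ramification indices of the finite subextensions of `E/K`. -/
def IsInfinitelyWildlyRamified (p : ℕ) (E : IntermediateField K (AlgebraicClosure K)) : Prop :=
  ∀ m : ℕ, ∃ F : IntermediateField K (AlgebraicClosure K), F ≤ E ∧ FiniteDimensional K F ∧
    p ^ m ∣ ramificationIndex F

end Ramification

end Arboreal

end

open Polynomial

namespace Arboreal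

/-! ### Newton polygon estimates for roots over an ultrametric field. -/

section Ultrametric

variable {L : Type*} [NormedField L] [IsUltrametricDist L]

/-! Write `f(z) = z^l - c`. When `|c| > 1`, all points that reach `α` after sufficiently many steps
have norm `R = |c|^(1/l)`, and there `|f'| = λ := |l| R^(l-1)`. Since `λ^l = |l|^l |c|^(l-1)`, the
position of `v(c)` relative to `ν_∞` decides whether this quantity is greater than, equal to or less
than one (`v_trichotomy`).

If `λ > 1`, the iterates `f^k` have derivative of norm `λ^k`, so Newton approximation places a point
of level `n` next to each point of level `n + 1`, closer than any conjugate of the latter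
(`exists_krasner_approximation`). Krasner's argument then stops the growth of the fields.

Wild ramification is always detected by elements `x_n` of the field with `|x_n| = |x_{n+1}|^{d_n}`,
`p ∣ d_n`, `x_0 ≠ 0` and `|x_0| ≠ 1` (`HasWildSeq.isInfinitelyWildlyRamified`). To find them, pull a
pair of points back under `f`: the distances obey `r_n = max_i |C(l,i)| R^(l-i) r_{n+1}^i`. By
convexity the dominant index is eventually constant. It is `1` or divisible by `p`, and `1` is
impossible if `λ ≤ 1` and the distances vary. Ratios of successive differences then form the
sequence (`hasWildSeq_of_pair`). A starting pair is needed whose distance is not fixed by the growth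
function. For `λ < 1 < |c|`, a point and its closest conjugate do. For `λ = 1`, any distance greater
than one does; it comes from a root of unity if `l ≠ p`, and from the pair `z, f(z)` if `l = p` and
`α` is far from every fixed point. For `|c| ≤ 1` the same ideas are applied to norms or to distances
along a backward orbit. Outside the closed unit disk the `l`-th power governs directly; inside it
the sizes tend to `1`, where a monomial of exponent divisible by `p` wins
(`hasWildSeq_of_norm_le_one`).

In the remaining case `λ = 1`, `l = p`, `α` near a fixed point `b`, distinct points of one level are
at distance exactly one. Lagrange interpolation at the conjugates shows that adjoining them to
`K(b)` never enlarges the value group (`exists_norm_eq_of_mem_adjoin_simple`). Over a local field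
the extension is still infinite, because a finite one is locally compact and cannot hold arbitrarily
many uniformly separated points of bounded norm. -/

theorem norm_sub_le_max (x y : L) : ‖x - y‖ ≤ max ‖x‖ ‖y‖ := by
  simpa [sub_eq_add_neg] using IsUltrametricDist.norm_add_le_max x (-y)

theorem norm_add_eq_left {x y : L} (h : ‖y‖ < ‖x‖) : ‖x + y‖ = ‖x‖ := by
  rw [IsUltrametricDist.norm_add_eq_max_of_norm_ne_norm h.ne', max_eq_left h.le]

/-- Up to sign, the `i`-th coefficient is a sum of products of the roots with `i` of them omitted,
and each omitted root costs a factor of at least `ρ`. -/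
theorem norm_coeff_prod_X_sub_C_mul_pow_le (s : Multiset L) {ρ : ℝ} (hρ : 0 ≤ ρ)
    (h : ∀ x ∈ s, ρ ≤ ‖x‖) (i : ℕ) :
    ‖(s.map fun x => X - C x).prod.coeff i‖ * ρ ^ i ≤ ‖(s.map fun x => X - C x).prod.coeff 0‖ := by
  induction s using Multiset.induction_on generalizing i with
  | empty => rcases i with _ | i <;> simp [coeff_one]
  | cons a s ih =>
    have ih' := ih fun x hx => h x (Multiset.mem_cons_of_mem hx)
    have ha := h a (Multiset.mem_cons_self a s)
    set g := (s.map fun x => X - C x).prod with hg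
    rw [Multiset.map_cons, Multiset.prod_cons, ← hg]
    have h0 : ‖((X - C a) * g).coeff 0‖ = ‖a‖ * ‖g.coeff 0‖ := by simp [mul_coeff_zero]
    rcases i with _ | i
    · simp
    · rw [h0, sub_mul, coeff_sub, coeff_X_mul, coeff_C_mul]
      have h1 : ‖g.coeff i‖ * ρ ^ (i + 1) ≤ ‖a‖ * ‖g.coeff 0‖ := by
        calc ‖g.coeff i‖ * ρ ^ (i + 1) = ρ * (‖g.coeff i‖ * ρ ^ i) := by ring
          _ ≤ ‖a‖ * ‖g.coeff 0‖ := mul_le_mul ha (ih' i) (by positivity) (norm_nonneg _)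
      have h2 : ‖a * g.coeff (i + 1)‖ * ρ ^ (i + 1) ≤ ‖a‖ * ‖g.coeff 0‖ := by
        rw [norm_mul, mul_assoc]
        exact mul_le_mul_of_nonneg_left (ih' _) (norm_nonneg _)
      calc _ ≤ max ‖g.coeff i‖ ‖a * g.coeff (i + 1)‖ * ρ ^ (i + 1) :=
            mul_le_mul_of_nonneg_right (norm_sub_le_max _ _) (by positivity)
        _ = max (‖g.coeff i‖ * ρ ^ (i + 1)) (‖a * g.coeff (i + 1)‖ * ρ ^ (i + 1)) :=
            max_mul_of_nonneg _ _ (by positivity)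
        _ ≤ _ := max_le h1 h2

/-- A polynomial with nonzero constant term has a root (one of minimal norm) at which no monomial
exceeds the constant term, while some nonconstant monomial has the size of the constant term. -/
theorem exists_root_dominant [IsAlgClosed L] {g : L[X]} (h0 : g.coeff 0 ≠ 0)
    (hdeg : g.natDegree ≠ 0) :
    ∃ h, g.eval h = 0 ∧ (∀ i, ‖g.coeff i‖ * ‖h‖ ^ i ≤ ‖g.coeff 0‖) ∧
      ∃ i, i ≠ 0 ∧ ‖g.coeff i‖ * ‖h‖ ^ i = ‖g.coeff 0‖ := by
  classical
  have hg : g ≠ 0 := by rintro rfl; simp at h0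
  have hs : g.Splits := IsAlgClosed.splits g
  obtain ⟨z, hz⟩ := IsAlgClosed.exists_root g
    (fun h => hdeg (natDegree_eq_zero_iff_degree_le_zero.2 h.le))
  have hne : g.roots.toFinset.Nonempty := ⟨z, by simpa [hg] using hz⟩
  obtain ⟨h, hh, hmin⟩ := Finset.exists_min_image _ (fun x => ‖x‖) hne
  have hroot : g.eval h = 0 := by simpa [hg] using hh
  have hle : ∀ i, ‖g.coeff i‖ * ‖h‖ ^ i ≤ ‖g.coeff 0‖ := by
    intro i
    have := norm_coeff_prod_X_sub_C_mul_pow_le g.roots (norm_nonneg h)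
      (fun x hx => hmin x (by simpa using hx)) i
    rw [hs.eq_prod_roots, coeff_C_mul, coeff_C_mul, norm_mul, norm_mul, mul_assoc]
    exact mul_le_mul_of_nonneg_left this (norm_nonneg _)
  refine ⟨h, hroot, hle, ?_⟩
  -- At a root the nonconstant monomials sum to minus the constant term, so by the ultrametric
  -- inequality one of them is at least as large.
  have hsum : g.coeff 0 = -∑ i ∈ Finset.range g.natDegree, g.coeff (i + 1) * h ^ (i + 1) := by
    rw [eval_eq_sum_range, Finset.sum_range_succ'] at hroot
    simp only [pow_zero, mul_one] at hroot
    linear_combination hroot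
  obtain ⟨i, -, hi⟩ := IsUltrametricDist.exists_norm_finsetSum_le (Finset.range g.natDegree)
    (fun i => g.coeff (i + 1) * h ^ (i + 1))
  refine ⟨i + 1, by omega, le_antisymm (hle _) ?_⟩
  rw [← norm_pow, ← norm_mul]
  calc ‖g.coeff 0‖ = _ := by rw [hsum, norm_neg]
    _ ≤ _ := hi

/-- Newton's estimate: near `b` there is a solution of `g = w` whose distance
to `b` is at most `|g b - w| / |g' b|`. -/
theorem exists_eval_eq_norm_derivative_mul_le [IsAlgClosed L] {g : L[X]} (hdeg : g.natDegree ≠ 0)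
    (b w : L) : ∃ y, g.eval y = w ∧ ‖g.derivative.eval b‖ * ‖y - b‖ ≤ ‖g.eval b - w‖ := by
  by_cases h : g.eval b = w
  · exact ⟨b, h, by simp⟩
  have hc0 : (taylor b g - C w).coeff 0 = g.eval b - w := by simp [taylor_coeff_zero]
  obtain ⟨y, hy, hle, -⟩ := exists_root_dominant (g := taylor b g - C w)
    (by rw [hc0]; exact sub_ne_zero.2 h) (by rwa [natDegree_sub_C, natDegree_taylor])
  refine ⟨y + b, ?_, ?_⟩
  · simpa [taylor_eval, sub_eq_zero] using hy
  -- The linear Taylor coefficient at `b` is the derivative there.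
  · have := hle 1
    rw [hc0] at this
    simpa [taylor_coeff_one, coeff_C] using this

end Ultrametric

/-! ### Growth functions `r ↦ max_i a_i r^i` and their backward orbits. -/

/-- `s` is the largest of the monomials `a i * r ^ i`, `1 ≤ i ≤ l`. -/
def IsMaxMonomial (l : ℕ) (a : ℕ → ℝ) (r s : ℝ) : Prop :=
  (∀ i ∈ Finset.Icc 1 l, a i * r ^ i ≤ s) ∧ ∃ i ∈ Finset.Icc 1 l, a i * r ^ i = s

/-- `d` is the largest index of a monomial attaining the maximum. -/
def IsTopIndex (l : ℕ) (a : ℕ → ℝ) (r : ℝ) (d : ℕ) : Prop :=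
  d ∈ Finset.Icc 1 l ∧ (∀ i ∈ Finset.Icc 1 l, a i * r ^ i ≤ a d * r ^ d) ∧
    ∀ i ∈ Finset.Icc 1 l, d < i → a i * r ^ i < a d * r ^ d

/-- Every exponent is at least one, and `s > 0` makes the coefficient of the winning monomial
nonzero, so that monomial strictly increases with `r`. -/
theorem IsMaxMonomial.lt {l : ℕ} {a : ℕ → ℝ} (ha : ∀ i, 0 ≤ a i) {r r' s s' : ℝ}
    (hs : 0 < s) (hr : 0 ≤ r) (h : IsMaxMonomial l a r s) (h' : IsMaxMonomial l a r' s')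
    (hrr : r < r') : s < s' := by
  obtain ⟨i, hi, his⟩ := h.2
  refine lt_of_lt_of_le ?_ (h'.1 i hi)
  have hai : 0 < a i := (ha i).lt_of_ne fun h0 => by rw [← h0, zero_mul] at his; exact hs.ne his
  rw [← his]
  exact mul_lt_mul_of_pos_left
    (pow_lt_pow_left₀ hrr hr (by have := (Finset.mem_Icc.1 hi).1; omega)) hai

theorem IsMaxMonomial.exists_isTopIndex {l : ℕ} {a : ℕ → ℝ} {r s : ℝ}
    (h : IsMaxMonomial l a r s) : ∃ d, IsTopIndex l a r d ∧ s = a d * r ^ d := by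
  classical
  obtain ⟨i, hi, his⟩ := h.2
  obtain ⟨d, hd, hmax⟩ := Finset.exists_max_image
    ((Finset.Icc 1 l).filter fun i => a i * r ^ i = s) id ⟨i, by simp_all⟩
  rw [Finset.mem_filter] at hd
  refine ⟨d, ⟨hd.1, fun i hi => by rw [hd.2]; exact h.1 i hi, fun i hi hdi => ?_⟩, hd.2.symm⟩
  rw [hd.2]
  refine (h.1 i hi).lt_of_ne fun he => ?_
  exact absurd (hmax i (Finset.mem_filter.2 ⟨hi, he⟩)) (by simpa using hdi)

/-- In logarithmic coordinates the growth function is convex and piecewise linear, and its slopes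
are the dominant exponents. -/
theorem IsTopIndex.le_of_lt {l : ℕ} {a : ℕ → ℝ} (ha : ∀ i, 0 ≤ a i) {r r' : ℝ} {d d' : ℕ}
    (hr : 0 < r) (hrr : r < r') (h : IsTopIndex l a r d) (h' : IsTopIndex l a r' d') :
    d ≤ d' := by
  by_contra! hlt
  have h1 := h.2.1 d' h'.1
  have h2 := h'.2.2 d h.1 hlt
  refine h2.not_ge ?_
  have hr' : 0 < r' := hr.trans hrr
  obtain ⟨k, rfl⟩ := Nat.exists_eq_add_of_lt hlt
  have e1 : a d' ≤ a (d' + k + 1) * r ^ (k + 1) := by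
    rw [show r ^ (d' + k + 1) = r ^ (k + 1) * r ^ d' by ring, ← mul_assoc] at h1
    exact le_of_mul_le_mul_right h1 (by positivity)
  calc a d' * r' ^ d' ≤ (a (d' + k + 1) * r ^ (k + 1)) * r' ^ d' := by gcongr
    _ ≤ (a (d' + k + 1) * r' ^ (k + 1)) * r' ^ d' := by
      have := ha (d' + k + 1)
      gcongr
    _ = _ := by ring

theorem exists_eventually_const_of_monotone_or_antitone {d : ℕ → ℕ} {l : ℕ} (hl : ∀ n, d n ≤ l)
    (h : Monotone d ∨ Antitone d) : ∃ N, ∀ n, N ≤ n → d n = d N := by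
  rcases h with h | h
  · classical
    have hex : ∃ m, ∃ n, d n = l - m := ⟨l - d 0, 0, by have := hl 0; omega⟩
    obtain ⟨n0, hn0⟩ := Nat.find_spec hex
    refine ⟨n0, fun n hn => le_antisymm ?_ (h hn)⟩
    by_contra! hlt
    exact Nat.find_min hex (m := l - d n) (by have := hl n; omega) ⟨n, by have := hl n; omega⟩
  · classical
    have hex : ∃ m, ∃ n, d n = m := ⟨d 0, 0, rfl⟩
    obtain ⟨n0, hn0⟩ := Nat.find_spec hex
    refine ⟨n0, fun n hn => le_antisymm (h hn) ?_⟩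
    rw [hn0]
    exact Nat.find_min' hex ⟨n, rfl⟩

/-- A bounded nonconstant backward orbit of `r ↦ max_i a i * r ^ i` eventually follows a single
monomial whose exponent is divisible by `p`. -/
theorem exists_dvd_monomial_of_backward_orbit {p l : ℕ} {a : ℕ → ℝ} (ha : ∀ i, 0 ≤ a i)
    (ha1 : a 1 ≤ 1) {R : ℝ}
    (htop : ∀ r d, 0 < r → r ≤ R → IsTopIndex l a r d → d = 1 ∨ p ∣ d)
    {r : ℕ → ℝ} (hr : ∀ n, 0 < r n) (hrR : ∀ n, r n ≤ R)
    (hstep : ∀ n, IsMaxMonomial l a (r (n + 1)) (r n)) (h01 : r 0 ≠ r 1) :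
    ∃ N d, p ∣ d ∧ r N ≠ r (N + 1) ∧ ∀ n, N ≤ n → r n = a d * r (n + 1) ^ d := by
  -- The growth function is strictly increasing, so the comparison of the first two terms propagates
  -- along the orbit.
  have hcase : (∀ n, r n < r (n + 1)) ∨ (∀ n, r (n + 1) < r n) := by
    have key : ∀ m n, r (m + 1) < r (n + 1) ↔ r m < r n := by
      intro m n
      refine ⟨fun h => (hstep m).lt ha (hr m) (hr _).le (hstep n) h, fun h => ?_⟩
      by_contra! hle
      rcases hle.lt_or_eq with h' | h'
      · exact h.not_gt ((hstep n).lt ha (hr n) (hr _).le (hstep m) h')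
      · obtain ⟨i, hi, his⟩ := (hstep n).2
        have := (hstep m).1 i hi
        rw [← h', his] at this
        exact h.not_ge this
    rcases h01.lt_or_gt with h | h
    · left; intro n
      induction n with
      | zero => exact h
      | succ n ih => exact (key _ _).2 ih
    · right; intro n
      induction n with
      | zero => exact h
      | succ n ih => exact (key _ _).2 ih
  choose d hd hrd using fun n => (hstep n).exists_isTopIndex
  have hmono : Monotone d ∨ Antitone d := by
    rcases hcase with h | h
    · exact Or.inl (monotone_nat_of_le_succ fun n => (hd n).le_of_lt ha (hr _) (h _) (hd (n + 1)))
    · exact Or.inr (antitone_nat_of_succ_le fun n => (hd (n + 1)).le_of_lt ha (hr _) (h _) (hd n))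
  obtain ⟨N, hN⟩ := exists_eventually_const_of_monotone_or_antitone
    (fun n => (Finset.mem_Icc.1 (hd n).1).2) hmono
  have hrec : ∀ n, N ≤ n → r n = a (d N) * r (n + 1) ^ d N := fun n hn => by
    rw [← hN n hn]; exact hrd n
  have hne : r N ≠ r (N + 1) := by
    rcases hcase with h | h
    · exact (h N).ne
    · exact (h N).ne'
  refine ⟨N, d N, (htop _ _ (hr _) (hrR _) (hd N)).resolve_left fun h1 => ?_, hne, hrec⟩
  -- With exponent `1` the orbit is eventually geometric, `r_N = a_1^k r_{N+k}`. Here `a_1 = 1`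
  -- contradicts `r_N ≠ r_{N+1}`, and `a_1 < 1` contradicts the bound `R`.
  rw [h1] at hrec
  simp only [pow_one] at hrec
  have hlt : ∀ n, r n < r (n + 1) := by
    refine hcase.resolve_right fun h => (h N).not_ge ?_
    rw [hrec N le_rfl]
    exact mul_le_of_le_one_left (hr _).le ha1
  have ha1' : a 1 < 1 := by
    by_contra! h
    have := hrec N le_rfl
    rw [le_antisymm ha1 h, one_mul] at this
    exact hne this
  have hpow : ∀ k, r N = a 1 ^ k * r (N + k) := by
    intro k
    induction k with
    | zero => simp
    | succ k ih => rw [ih, hrec (N + k) (by omega), pow_succ, ← add_assoc, mul_assoc]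
  have hR : 0 < R := (hr 0).trans_le (hrR 0)
  obtain ⟨k, hk⟩ := exists_pow_lt_of_lt_one (div_pos (hr N) hR) ha1'
  rw [lt_div_iff₀ hR] at hk
  refine hk.not_ge ?_
  rw [hpow k]
  exact mul_le_mul_of_nonneg_left (hrR _) (pow_nonneg (ha 1) k)

/-! ### Wild sequences from pairs of points on a circle. -/

section Wild

variable {L : Type*} [NormedField L]

/-- `E` contains a sequence of elements, each of the size of a `d`-th power of the next one with
`p ∣ d`, and starting with an element that is neither zero nor of norm one. -/
def HasWildSeq (p : ℕ) (E : Subfield L) : Prop :=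
  ∃ (x : ℕ → L) (d : ℕ → ℕ), (∀ n, x n ∈ E) ∧ x 0 ≠ 0 ∧ ‖x 0‖ ≠ 1 ∧
    ∀ n, p ∣ d n ∧ ‖x n‖ = ‖x (n + 1)‖ ^ d n

/-- The size of the coefficients of `(b + T) ^ l - b ^ l` for `|b| = R`. -/
noncomputable def binomialSize (L : Type*) [NormedField L] (l : ℕ) (R : ℝ) (i : ℕ) : ℝ :=
  ‖((l.choose i : ℕ) : L)‖ * R ^ (l - i)

theorem binomialSize_nonneg {l : ℕ} {R : ℝ} (hR : 0 ≤ R) (i : ℕ) : 0 ≤ binomialSize L l R i := by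
  unfold binomialSize; positivity

theorem coeff_X_add_C_pow_sub_C (l : ℕ) (b e : L) {i : ℕ} (hi : i ≠ 0) :
    ‖((X + C b) ^ l - C e).coeff i‖ = binomialSize L l ‖b‖ i := by
  rw [coeff_sub, coeff_C_of_ne_zero hi, sub_zero, coeff_X_add_C_pow, norm_mul, norm_pow, mul_comm]
  rfl

variable [IsUltrametricDist L]

theorem norm_natCast_eq_one_of_not_dvd {p : ℕ} (hp : p.Prime) (hp1 : ‖(p : L)‖ < 1) {i : ℕ}
    (hi : ¬ p ∣ i) : ‖(i : L)‖ = 1 := by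
  refine le_antisymm (IsUltrametricDist.norm_natCast_le_one L i) ?_
  by_contra! hlt
  have hcop : IsCoprime (p : ℤ) (i : ℤ) :=
    Nat.isCoprime_iff_coprime.2 ((Nat.Prime.coprime_iff_not_dvd hp).2 hi)
  obtain ⟨u, w, h⟩ := hcop
  have h' : (u : L) * p + w * i = 1 := by exact_mod_cast congrArg (Int.cast (R := L)) h
  have h1 : ‖(u : L) * p‖ < 1 := by
    rw [norm_mul]
    exact mul_lt_one_of_nonneg_of_lt_one_right (IsUltrametricDist.norm_intCast_le_one L u)
      (norm_nonneg _) hp1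
  have h2 : ‖(w : L) * i‖ < 1 := by
    rw [norm_mul]
    exact mul_lt_one_of_nonneg_of_lt_one_right (IsUltrametricDist.norm_intCast_le_one L w)
      (norm_nonneg _) hlt
  have := (IsUltrametricDist.norm_add_le_max ((u : L) * p) (w * i)).trans_lt (max_lt h1 h2)
  rw [h', norm_one] at this
  exact lt_irrefl _ this

/-- Take norms in `i * C(l,i) = l * C(l-1,i-1)`, where `i` is a unit. -/
theorem norm_choose_le {p : ℕ} (hp : p.Prime) (hp1 : ‖(p : L)‖ < 1) {l i : ℕ}
    (hi : ¬ p ∣ i) : ‖((l.choose i : ℕ) : L)‖ ≤ ‖(l : L)‖ := by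
  rcases i with _ | i
  · simp at hi
  rcases l with _ | l
  · simp
  have h := congrArg (Nat.cast (R := L)) (Nat.add_one_mul_choose_eq l i)
  push_cast at h
  have h2 := congrArg norm h
  rw [norm_mul, norm_mul] at h2
  have h3 := norm_natCast_eq_one_of_not_dvd hp hp1 hi
  push_cast at h3 ⊢
  rw [h3, mul_one] at h2
  rw [← h2]
  exact mul_le_of_le_one_right (norm_nonneg _) (IsUltrametricDist.norm_natCast_le_one L _)

/-- The preimage of `w` under `z ↦ z ^ l` closest to `b`. -/
theorem exists_pow_eq_isMaxMonomial [IsAlgClosed L] {l : ℕ} (hl : l ≠ 0) {b w : L}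
    (h : b ^ l ≠ w) :
    ∃ y, y ^ l = w ∧ y ≠ b ∧ IsMaxMonomial l (binomialSize L l ‖b‖) ‖y - b‖ ‖b ^ l - w‖ := by
  have hdeg : ((X + C b) ^ l - C w : L[X]).natDegree = l := by
    rw [natDegree_sub_C, natDegree_pow, natDegree_X_add_C, mul_one]
  have hc0 : ((X + C b) ^ l - C w : L[X]).coeff 0 = b ^ l - w := by
    simp [coeff_zero_eq_eval_zero]
  obtain ⟨y, hy, hle, i, hi0, hi⟩ := exists_root_dominant (g := (X + C b) ^ l - C w)
    (by rw [hc0]; exact sub_ne_zero.2 h) (by rwa [hdeg])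
  have hyw : (y + b) ^ l = w := by simpa [sub_eq_zero] using hy
  refine ⟨y + b, hyw, ?_, ?_, i, ?_, ?_⟩
  · rintro hyb
    rw [hyb] at hyw
    exact h hyw
  · intro i hi
    have hi0 : i ≠ 0 := by have := (Finset.mem_Icc.1 hi).1; omega
    have := hle i
    rwa [coeff_X_add_C_pow_sub_C _ _ _ hi0, hc0, show y = y + b - b by ring] at this
  · rw [Finset.mem_Icc]
    refine ⟨by omega, ?_⟩
    by_contra! hlt
    rw [coeff_eq_zero_of_natDegree_lt (by rw [hdeg]; exact hlt), norm_zero, zero_mul, hc0] at hi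
    exact sub_ne_zero.2 h (norm_eq_zero.1 hi.symm)
  · rwa [coeff_X_add_C_pow_sub_C _ _ _ hi0, hc0, show y = y + b - b by ring] at hi

/-- For `d` prime to `p` the binomial coefficient is at most `|l|` in norm. If `d ≥ 2`, its monomial
then loses to the linear one when `r < R`, and to the one of degree `l` when `r = R`. -/
theorem eq_one_or_dvd_of_isTopIndex {p : ℕ} (hp : p.Prime) (hp1 : ‖(p : L)‖ < 1) {l : ℕ}
    (hl0 : (l : L) ≠ 0) (hpl : p ∣ l) {R r : ℝ} {d : ℕ} (hr : 0 < r) (hrR : r ≤ R)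
    (h : IsTopIndex l (binomialSize L l R) r d) : d = 1 ∨ p ∣ d := by
  by_contra! hcon
  obtain ⟨hd1, hpd⟩ := hcon
  obtain ⟨hd, hmax, htop⟩ := h
  rw [Finset.mem_Icc] at hd
  have hR : 0 < R := hr.trans_le hrR
  have hlpos : 0 < ‖(l : L)‖ := norm_pos_iff.2 hl0
  have hdl : d < l := lt_of_le_of_ne hd.2 fun h => hpd (h ▸ hpl)
  have hl1 : ‖(l : L)‖ < 1 := by
    obtain ⟨k, rfl⟩ := hpl
    push_cast
    rw [norm_mul]
    exact mul_lt_one_of_nonneg_of_lt_one_left (norm_nonneg _) hp1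
      (IsUltrametricDist.norm_natCast_le_one L k)
  have hle : binomialSize L l R d * r ^ d ≤ ‖(l : L)‖ * R ^ (l - d) * r ^ d := by
    unfold binomialSize
    have := norm_choose_le (L := L) hp hp1 (l := l) hpd
    gcongr
  rcases hrR.lt_or_eq with hlt | rfl
  · have h1 := hmax 1 (Finset.mem_Icc.2 ⟨le_rfl, by omega⟩)
    refine (h1.trans hle).not_gt ?_
    unfold binomialSize
    obtain ⟨k, rfl⟩ : ∃ k, d = k + 2 := ⟨d - 2, by omega⟩
    obtain ⟨m, rfl⟩ : ∃ m, l = k + 2 + m := ⟨l - (k + 2), by omega⟩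
    rw [Nat.choose_one_right, show k + 2 + m - (k + 2) = m by omega,
      show k + 2 + m - 1 = m + (k + 1) by omega, pow_add, pow_one]
    have : r ^ (k + 1) < R ^ (k + 1) := pow_lt_pow_left₀ hlt hr.le (by omega)
    calc _ = ‖((k + 2 + m : ℕ) : L)‖ * R ^ m * r * r ^ (k + 1) := by ring
      _ < ‖((k + 2 + m : ℕ) : L)‖ * R ^ m * r * R ^ (k + 1) := by gcongr
      _ = _ := by ring
  · have h1 := hmax l (Finset.mem_Icc.2 ⟨by omega, le_rfl⟩)
    refine (h1.trans hle).not_gt ?_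
    unfold binomialSize
    rw [Nat.choose_self, Nat.sub_self, mul_assoc, ← pow_add, Nat.sub_add_cancel hd.2]
    simp only [Nat.cast_one, norm_one, pow_zero, mul_one, one_mul]
    exact mul_lt_of_lt_one_left (by positivity) hl1

/-- If all points of a set stable under taking preimages have norm `R`, then two points of it whose
distance is not a fixed point of the growth function give rise to wild ramification. -/
theorem hasWildSeq_of_pair [IsAlgClosed L] {p : ℕ} (hp : p.Prime) (hp1 : ‖(p : L)‖ < 1) {l : ℕ}
    (hl0 : (l : L) ≠ 0) (hpl : p ∣ l) {c : L} {R : ℝ} (hlam : ‖(l : L)‖ * R ^ (l - 1) ≤ 1)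
    {E : Subfield L} {T : Set L} (hTE : T ⊆ E) (hT : ∀ z, z ^ l - c ∈ T → z ∈ T)
    (hTR : ∀ z ∈ T, ‖z‖ = R) {z w : L} (hz : z ∈ T) (hw : w ∈ T) (hzw : z ≠ w)
    (hfix : ¬ IsMaxMonomial l (binomialSize L l R) ‖z - w‖ ‖z - w‖) : HasWildSeq p E := by
  have hln : l ≠ 0 := by rintro rfl; simp at hl0
  have hR : 0 ≤ R := by rw [← hTR z hz]; exact norm_nonneg _
  -- Pull a pair back: take any preimage `b` of the second point, then the preimage of the first
  -- that is closest to `b`.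
  have hnext : ∀ q : {q : L × L // q.1 ∈ T ∧ q.2 ∈ T ∧ q.1 ≠ q.2},
      ∃ q' : {q : L × L // q.1 ∈ T ∧ q.2 ∈ T ∧ q.1 ≠ q.2},
        IsMaxMonomial l (binomialSize L l R) ‖q'.1.1 - q'.1.2‖ ‖q.1.1 - q.1.2‖ := by
    rintro ⟨⟨x, y⟩, hx, hy, hxy⟩
    obtain ⟨b, hb⟩ := IsAlgClosed.exists_pow_nat_eq (y + c) (Nat.pos_of_ne_zero hln)
    have hbT : b ∈ T := hT b (by rw [hb, add_sub_cancel_right]; exact hy)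
    obtain ⟨t, ht, htb, hmax⟩ := exists_pow_eq_isMaxMonomial (l := l) hln (b := b) (w := x + c)
      (by rw [hb]; exact fun h => hxy (add_right_cancel h).symm)
    have htT : t ∈ T := hT t (by rw [ht, add_sub_cancel_right]; exact hx)
    refine ⟨⟨(t, b), htT, hbT, htb⟩, ?_⟩
    rw [hTR b hbT, hb, add_sub_add_right_eq_sub, norm_sub_rev y x] at hmax
    exact hmax
  choose nx hnx using hnext
  set q : ℕ → {q : L × L // q.1 ∈ T ∧ q.2 ∈ T ∧ q.1 ≠ q.2} := fun n => nx^[n] ⟨(z, w), hz, hw, hzw⟩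
    with hq
  have hqs : ∀ n, q (n + 1) = nx (q n) := fun n => Function.iterate_succ_apply' _ _ _
  set r : ℕ → ℝ := fun n => ‖(q n).1.1 - (q n).1.2‖ with hr
  have hstep : ∀ n, IsMaxMonomial l (binomialSize L l R) (r (n + 1)) (r n) := fun n => by
    simp only [hr, hqs]; exact hnx _
  have hrpos : ∀ n, 0 < r n := fun n => norm_pos_iff.2 (sub_ne_zero.2 (q n).2.2.2)
  have hrR : ∀ n, r n ≤ R := fun n => by
    refine (norm_sub_le_max _ _).trans ?_
    rw [hTR _ (q n).2.1, hTR _ (q n).2.2.1, max_self]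
  obtain ⟨N, d, hpd, hne, hrec⟩ := exists_dvd_monomial_of_backward_orbit (p := p)
    (binomialSize_nonneg (L := L) hR)
    (by unfold binomialSize; rw [Nat.choose_one_right]; exact hlam)
    (fun r d hr hrR => eq_one_or_dvd_of_isTopIndex hp hp1 hl0 hpl hr hrR) hrpos hrR hstep
    (fun h => hfix (by have := hstep 0; rw [← h] at this; exact this))
  -- In the ratios of successive differences the constant coefficient of `r_n = A r_{n+1}^d`
  -- cancels; the first ratio has norm different from one because `r_N ≠ r_{N+1}`.
  refine ⟨fun n => ((q (N + n)).1.1 - (q (N + n)).1.2) / ((q (N + n + 1)).1.1 - (q (N + n + 1)).1.2),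
    fun _ => d, fun n => ?_, ?_, ?_, fun n => ⟨hpd, ?_⟩⟩
  · exact E.div_mem (E.sub_mem (hTE (q _).2.1) (hTE (q _).2.2.1))
      (E.sub_mem (hTE (q _).2.1) (hTE (q _).2.2.1))
  · exact div_ne_zero (sub_ne_zero.2 (q _).2.2.2) (sub_ne_zero.2 (q _).2.2.2)
  · rw [norm_div]
    intro h
    rw [div_eq_one_iff_eq (hrpos (N + 1)).ne'] at h
    exact hne h
  · rw [norm_div, norm_div]
    change r (N + n) / r (N + n + 1) = (r (N + n + 1) / r (N + n + 1 + 1)) ^ d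
    have e1 := hrec (N + n) (by omega)
    have e2 := hrec (N + n + 1) (by omega)
    have hA : binomialSize L l R d ≠ 0 := fun h0 => by
      rw [h0, zero_mul] at e1; exact (hrpos _).ne' e1
    have p1 := (hrpos (N + n + 1)).ne'
    have p2 := (hrpos (N + n + 1 + 1)).ne'
    rw [e1, div_pow]
    nth_rewrite 2 [e2]
    field_simp

end Wild

/-! ### Iterates as polynomials. -/

section Iterate

/-- The `n`-th iterate of `X ^ l - c` as a polynomial. -/
noncomputable def iteratePoly {A : Type*} [CommRing A] (l : ℕ) (c : A) : ℕ → A[X]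
  | 0 => X
  | n + 1 => (iteratePoly l c n).comp (X ^ l - C c)

theorem eval_iteratePoly {A : Type*} [CommRing A] (l : ℕ) (c : A) (n : ℕ) (z : A) :
    (iteratePoly l c n).eval z = (fun z => z ^ l - c)^[n] z := by
  induction n generalizing z with
  | zero => simp [iteratePoly]
  | succ n ih => rw [iteratePoly, eval_comp, ih, Function.iterate_succ_apply]; simp

theorem map_iteratePoly {A B : Type*} [CommRing A] [CommRing B] (φ : A →+* B) (l : ℕ) (c : A)
    (n : ℕ) : (iteratePoly l c n).map φ = iteratePoly l (φ c) n := by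
  induction n with
  | zero => simp [iteratePoly]
  | succ n ih => rw [iteratePoly, iteratePoly, map_comp, ih]; simp

/-- The innermost substitution involves only `X ^ l`, so a positive iterate is a polynomial in `X ^
l`. -/
theorem coeff_iteratePoly_eq_zero {A : Type*} [CommRing A] {l : ℕ} (hl : 0 < l) (c : A) (n : ℕ)
    {i : ℕ} (hi : ¬ l ∣ i) : (iteratePoly l c (n + 1)).coeff i = 0 := by
  have : iteratePoly l c (n + 1) = expand A l ((iteratePoly l c n).comp (X - C c)) := by
    rw [iteratePoly, expand_eq_comp_X_pow, comp_assoc]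
    simp
  rw [this, coeff_expand hl, if_neg hi]

variable {L : Type*} [NormedField L]

theorem natDegree_iteratePoly (l : ℕ) (c : L) (n : ℕ) :
    (iteratePoly l c n).natDegree = l ^ n := by
  induction n with
  | zero => simp [iteratePoly]
  | succ n ih => rw [iteratePoly, natDegree_comp, ih, natDegree_X_pow_sub_C, pow_succ]

theorem monic_iteratePoly {l : ℕ} (hl : l ≠ 0) (c : L) (n : ℕ) : (iteratePoly l c n).Monic := by
  induction n with
  | zero => exact monic_X
  | succ n ih =>
    exact ih.comp (monic_X_pow_sub_C c hl) (by rwa [natDegree_X_pow_sub_C])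

theorem eval_derivative_iteratePoly_succ (l : ℕ) (c : L) (n : ℕ) (z : L) :
    (iteratePoly l c (n + 1)).derivative.eval z =
      l * z ^ (l - 1) * (iteratePoly l c n).derivative.eval (z ^ l - c) := by
  rw [iteratePoly, derivative_comp]
  simp [derivative_X_pow]

variable [IsUltrametricDist L]

theorem norm_coeff_iteratePoly_le_one {c : L} (hc : ‖c‖ ≤ 1) (l n i : ℕ) :
    ‖(iteratePoly l c n).coeff i‖ ≤ 1 := by
  let O := (NormedField.valuation (K := L)).integer
  have hcO : c ∈ O := hc
  have := map_iteratePoly O.subtype l ⟨c, hcO⟩ n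
  rw [Subring.subtype_apply] at this
  rw [← this, coeff_map]
  exact ((iteratePoly l (⟨c, hcO⟩ : O) n).coeff i).2

end Iterate

/-! ### Real sequences approaching radius one. -/

section RealEstimates

theorem exists_lt_one_forall_lt_pow {κ : ℝ} (hκ : κ < 1) (D : ℕ) :
    ∃ μ, 0 ≤ μ ∧ μ < 1 ∧ ∀ r : ℝ, μ < r → r < 1 → κ < r ^ D := by
  have h : ∀ᶠ r : ℝ in nhds 1, κ < r ^ D :=
    (continuous_pow D).continuousAt.eventually (lt_mem_nhds (by simpa using hκ))
  obtain ⟨a, ha, h1⟩ := exists_Ioc_subset_of_mem_nhds h ⟨0, zero_lt_one⟩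
  exact ⟨max a 0, le_max_right _ _, max_lt ha zero_lt_one, fun r hr hr1 =>
    h1 ⟨(le_max_left _ _).trans_lt hr, hr1.le⟩⟩

/-- Close to radius one, a single monomial of a polynomial with integral coefficients dominates. -/
theorem exists_dominant_index {l : ℕ} (hl : l ≠ 0) {a : ℕ → ℝ} (ha0 : ∀ i, 0 ≤ a i)
    (ha : ∀ i, a i ≤ 1) (hal : a l = 1) :
    ∃ j ∈ Finset.Icc 1 l, a j = 1 ∧ ∃ μ, 0 ≤ μ ∧ μ < 1 ∧ ∀ r, μ < r → r < 1 →
      ∀ i ∈ Finset.Icc 1 l, i ≠ j → a i * r ^ i < r ^ j := by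
  classical
  -- The winner is the smallest index with coefficient one: higher powers are smaller inside the
  -- unit disk, and lower coefficients are at most some `κ < 1`, which `r ^ j` exceeds near `r = 1`.
  have hex : ∃ j, 1 ≤ j ∧ a j = 1 := ⟨l, by omega, hal⟩
  obtain ⟨hj1, hj⟩ := Nat.find_spec hex
  set j := Nat.find hex with hjdef
  have hjl : j ≤ l := Nat.find_min' hex ⟨by omega, hal⟩
  obtain ⟨κ, hκ1, hκ⟩ : ∃ κ < 1, ∀ i ∈ Finset.Ico 1 j, a i ≤ κ := by
    rcases (Finset.Ico 1 j).eq_empty_or_nonempty with h | h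
    · exact ⟨0, zero_lt_one, by simp [h]⟩
    · obtain ⟨m, hm, hmax⟩ := Finset.exists_max_image _ a h
      refine ⟨a m, (ha m).lt_of_ne fun h1 => ?_, hmax⟩
      rw [Finset.mem_Ico] at hm
      exact Nat.find_min hex hm.2 ⟨hm.1, h1⟩
  obtain ⟨μ, hμ0, hμ1, hμ⟩ := exists_lt_one_forall_lt_pow hκ1 j
  refine ⟨j, Finset.mem_Icc.2 ⟨hj1, hjl⟩, hj, μ, hμ0, hμ1, fun r hr hr1 i hi hij => ?_⟩
  have hr0 : 0 < r := hμ0.trans_lt hr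
  rw [Finset.mem_Icc] at hi
  rcases lt_or_gt_of_ne hij with h | h
  · calc a i * r ^ i ≤ a i := mul_le_of_le_one_right (ha0 i) (pow_le_one₀ hr0.le hr1.le)
      _ ≤ κ := hκ i (Finset.mem_Ico.2 ⟨hi.1, h⟩)
      _ < r ^ j := hμ r hr hr1
  · calc a i * r ^ i ≤ r ^ i := mul_le_of_le_one_left (pow_nonneg hr0.le _) (ha i)
      _ < r ^ j := pow_lt_pow_right_of_lt_one₀ hr0 hr1 h

/-- The sequence is nondecreasing. If it stayed below `μ`, each term would be at most `max κ μ < 1`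
times the next, and `r 0 > 0` would be arbitrarily small. This drives backward orbits into the range
where a single monomial dominates. -/
theorem exists_forall_lt_of_le_max {r : ℕ → ℝ} {κ : ℝ} (hκ : κ < 1)
    (hr0 : ∀ n, 0 < r n) (hr1 : ∀ n, r n < 1)
    (h : ∀ n, r n ≤ max (κ * r (n + 1)) (r (n + 1) ^ 2)) {μ : ℝ} (hμ : μ < 1) :
    ∃ N, ∀ n, N ≤ n → μ < r n := by
  have hmono : Monotone r := monotone_nat_of_le_succ fun n => (h n).trans (max_le
    (mul_le_of_le_one_left (hr0 _).le hκ.le)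
    (by rw [sq]; exact mul_le_of_le_one_left (hr0 _).le (hr1 _).le))
  by_contra! hcon
  have hle : ∀ n, r n ≤ μ := fun n => by
    obtain ⟨m, hm, hmr⟩ := hcon n
    exact (hmono hm).trans hmr
  have hμ0 : 0 < μ := (hr0 0).trans_le (hle 0)
  set θ := max κ μ
  have hθ1 : θ < 1 := max_lt hκ hμ
  have hθ0 : 0 < θ := lt_max_of_lt_right hμ0
  have hstep : ∀ n, r n ≤ θ * r (n + 1) := fun n => (h n).trans (max_le
    (mul_le_mul_of_nonneg_right (le_max_left _ _) (hr0 _).le)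
    (by rw [sq]; exact mul_le_mul_of_nonneg_right ((hle _).trans (le_max_right _ _)) (hr0 _).le))
  have hpow : ∀ n, r 0 ≤ θ ^ n * r n := by
    intro n
    induction n with
    | zero => simp
    | succ n ih =>
      calc r 0 ≤ θ ^ n * r n := ih
        _ ≤ θ ^ n * (θ * r (n + 1)) := mul_le_mul_of_nonneg_left (hstep n) (by positivity)
        _ = _ := by ring
  obtain ⟨n, hn⟩ := exists_pow_lt_of_lt_one (hr0 0) hθ1
  exact hn.not_ge ((hpow n).trans (mul_le_of_le_one_right (by positivity) (hr1 n).le))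

end RealEstimates

/-! ### The backward tree of a point, and the contracting case with `|c| > 1`. -/

section Tree

variable {L : Type*} [NormedField L]

/-- The points that reach `a` after at least `N` iterations of `z ↦ z ^ l - c`. -/
def tree (l : ℕ) (c a : L) (N : ℕ) : Set L :=
  {z | ∃ n, N ≤ n ∧ (fun z => z ^ l - c)^[n] z = a}

theorem mem_tree_of_map_mem {l : ℕ} {c a : L} {N : ℕ} {z : L} (h : z ^ l - c ∈ tree l c a N) :
    z ∈ tree l c a N := by
  obtain ⟨n, hn, h⟩ := h
  exact ⟨n + 1, by omega, by rwa [Function.iterate_succ_apply]⟩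

theorem mem_tree_of_iterate_mem {l : ℕ} {c a : L} {N : ℕ} {z : L} (s : ℕ)
    (h : (fun z => z ^ l - c)^[s] z ∈ tree l c a N) : z ∈ tree l c a N := by
  induction s generalizing z with
  | zero => exact h
  | succ s ih => rw [Function.iterate_succ_apply] at h; exact mem_tree_of_map_mem (ih h)

theorem tree_subset {l : ℕ} {c a : L} {M N : ℕ} (h : M ≤ N) : tree l c a N ⊆ tree l c a M :=
  fun _ ⟨n, hn, hz⟩ => ⟨n, h.trans hn, hz⟩

theorem exists_preimage [IsAlgClosed L] {l : ℕ} (hl : l ≠ 0) (c w : L) : ∃ z, z ^ l - c = w := by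
  obtain ⟨z, hz⟩ := IsAlgClosed.exists_pow_nat_eq (w + c) (Nat.pos_of_ne_zero hl)
  exact ⟨z, by rw [hz, add_sub_cancel_right]⟩

theorem exists_backward_orbit [IsAlgClosed L] {l : ℕ} (hl : l ≠ 0) (c a : L) :
    ∃ z : ℕ → L, z 0 = a ∧ ∀ n, z (n + 1) ^ l - c = z n := by
  choose g hg using exists_preimage hl c
  exact ⟨fun n => g^[n] a, rfl, fun n => by
    simp only [Function.iterate_succ_apply']; exact hg _⟩

theorem iterate_backward_orbit {l : ℕ} {c : L} {z : ℕ → L} (hz : ∀ n, z (n + 1) ^ l - c = z n)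
    (m n : ℕ) : (fun z => z ^ l - c)^[m] (z (n + m)) = z n := by
  induction m with
  | zero => rfl
  | succ m ih => rw [Function.iterate_succ_apply, ← add_assoc, hz, ih]

theorem exists_mem_tree [IsAlgClosed L] {l : ℕ} (hl : l ≠ 0) (c a : L) (n : ℕ) :
    ∃ z, (fun z => z ^ l - c)^[n] z = a := by
  obtain ⟨z, hz0, hz⟩ := exists_backward_orbit hl c a
  exact ⟨z n, by simpa [hz0] using iterate_backward_orbit hz n 0⟩

variable [IsUltrametricDist L]

/-- If `|c| > 1`, all points of sufficiently high level have norm `|c| ^ (1 / l)`. -/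
theorem exists_forall_mem_tree_norm_pow_eq {l : ℕ} (hl : 2 ≤ l) {c : L} (hc : 1 < ‖c‖) (a : L) :
    ∃ N, ∀ z ∈ tree l c a N, ‖z‖ ^ l = ‖c‖ := by
  have hle : ∀ z, ‖z‖ ^ l ≤ max ‖z ^ l - c‖ ‖c‖ := fun z => by
    rw [← norm_pow]
    simpa using IsUltrametricDist.norm_add_le_max (z ^ l - c) c
  -- Taking roots repeatedly makes the influence of `a` fade.
  have hgrow : ∀ n z, (fun z => z ^ l - c)^[n + 1] z = a →
      ‖z‖ ^ l ^ (n + 1) ≤ max ‖a‖ (‖c‖ ^ l ^ n) := by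
    intro n
    induction n with
    | zero =>
      intro z hz
      have := hle z
      simp only [Nat.zero_add, Function.iterate_one] at hz
      simpa [hz] using this
    | succ n ih =>
      intro z hz
      rw [Function.iterate_succ_apply] at hz
      have h1 := ih _ hz
      calc ‖z‖ ^ l ^ (n + 1 + 1) = (‖z‖ ^ l) ^ l ^ (n + 1) := by rw [← pow_mul, ← pow_succ']
        _ ≤ (max ‖z ^ l - c‖ ‖c‖) ^ l ^ (n + 1) := by gcongr; exact hle z
        _ ≤ _ := by
          rcases le_total ‖z ^ l - c‖ ‖c‖ with h | h
          · rw [max_eq_right h]; exact le_max_right _ _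
          · rw [max_eq_left h]
            refine h1.trans (max_le_max le_rfl (pow_le_pow_right₀ hc.le ?_))
            exact Nat.pow_le_pow_right (by omega) (by omega)
  obtain ⟨m, hm⟩ := pow_unbounded_of_one_lt ‖a‖ hc
  have hsmall : ∀ n, m ≤ n → ∀ z, (fun z => z ^ l - c)^[n + 1] z = a → ‖z‖ < ‖c‖ := by
    intro n hn z hz
    have h1 := hgrow n z hz
    have h2 : ‖a‖ ≤ ‖c‖ ^ l ^ n := hm.le.trans (pow_le_pow_right₀ hc.le
      (hn.trans (Nat.lt_pow_self (by omega)).le))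
    rw [max_eq_right h2, pow_succ', pow_mul] at h1
    have h3 : ‖z‖ ^ l ≤ ‖c‖ := le_of_pow_le_pow_left₀ (by positivity) (norm_nonneg _) h1
    by_contra! h4
    have h5 : ‖c‖ ^ 1 < ‖c‖ ^ l := pow_lt_pow_right₀ hc (by omega)
    rw [pow_one] at h5
    exact (h5.trans_le (pow_le_pow_left₀ (norm_nonneg _) h4 l)).not_ge h3
  -- `f(z)` must itself have level at least `m + 1`: then `|f(z)| < |c|`, and `z ^ l = c + f(z)` has
  -- norm `|c|`.
  refine ⟨m + 2, fun z hz => ?_⟩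
  obtain ⟨n, hn, hz⟩ := hz
  obtain ⟨k, rfl⟩ : ∃ k, n = k + 1 + 1 := ⟨n - 2, by omega⟩
  rw [Function.iterate_succ_apply] at hz
  have := hsmall k (by omega) _ hz
  rw [← norm_pow, ← norm_add_eq_left this]
  congr 1
  ring

/-- The `l`-th power conjugate of `b` closest to `b`. -/
theorem exists_pow_eq_pow_closest [IsAlgClosed L] {l : ℕ} (hl : 2 ≤ l) (hl0 : (l : L) ≠ 0) {b : L}
    (hb : b ≠ 0) : ∃ y, y ^ l = b ^ l ∧ y ≠ b ∧ ∀ i ∈ Finset.Icc 1 l,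
      binomialSize L l ‖b‖ i * ‖y - b‖ ^ i ≤ ‖(l : L)‖ * ‖b‖ ^ (l - 1) * ‖y - b‖ := by
  set g : L[X] := divX ((X + C b) ^ l - C (b ^ l)) with hg
  -- Dividing by `X` removes the trivial root `y = b`; the constant term becomes `l b^(l-1)`, and a
  -- root of minimal norm is the closest conjugate.
  have hX : X * g = (X + C b) ^ l - C (b ^ l) := by
    have := X_mul_divX_add ((X + C b) ^ l - C (b ^ l))
    rw [← hg] at this
    rw [← this]
    simp [coeff_zero_eq_eval_zero]
  have hco : ∀ i, ‖g.coeff i‖ = binomialSize L l ‖b‖ (i + 1) := fun i => by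
    rw [hg, coeff_divX, coeff_X_add_C_pow_sub_C _ _ _ (by omega)]
  have hc0 : ‖g.coeff 0‖ = ‖(l : L)‖ * ‖b‖ ^ (l - 1) := by
    rw [hco, binomialSize, zero_add, Nat.choose_one_right]
  have hc0' : g.coeff 0 ≠ 0 := by
    rw [← norm_ne_zero_iff, hc0]
    exact mul_ne_zero (norm_ne_zero_iff.2 hl0) (pow_ne_zero _ (norm_ne_zero_iff.2 hb))
  have hdeg : g.natDegree = l - 1 := by
    rw [hg, natDegree_divX_eq_natDegree_tsub_one, natDegree_sub_C, natDegree_pow,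
      natDegree_X_add_C, mul_one]
  obtain ⟨h, hh, hle, -⟩ := exists_root_dominant hc0' (by omega)
  have hev := congrArg (eval h) hX
  rw [eval_mul, hh, mul_zero] at hev
  have hev' : (h + b) ^ l = b ^ l := by
    have : (h + b) ^ l - b ^ l = 0 := by simpa using hev.symm
    exact sub_eq_zero.1 this
  refine ⟨h + b, hev', ?_, ?_⟩
  · intro he
    have : h = 0 := by simpa using he
    rw [this, ← coeff_zero_eq_eval_zero] at hh
    exact hc0' hh
  · intro i hi
    obtain ⟨k, rfl⟩ : ∃ k, i = k + 1 := ⟨i - 1, by have := (Finset.mem_Icc.1 hi).1; omega⟩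
    have := hle k
    rw [hco, hc0] at this
    rw [add_sub_cancel_right, pow_succ, ← mul_assoc]
    exact mul_le_mul_of_nonneg_right this (norm_nonneg _)

theorem eq_of_pow_eq_of_nonneg {l : ℕ} (hl : l ≠ 0) {x y : ℝ} (hx : 0 ≤ x) (hy : 0 ≤ y)
    (h : x ^ l = y ^ l) : x = y := (pow_left_inj₀ hx hy hl).1 h

/-- At the distance `s` between a point and its closest conjugate no monomial exceeds the linear
one, which is `λ s < s`. So `s` is not fixed by the growth function. -/
theorem hasWildSeq_of_one_lt_norm [IsAlgClosed L] {p : ℕ} (hp : p.Prime) (hp1 : ‖(p : L)‖ < 1)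
    {l : ℕ} (hl : 2 ≤ l) (hl0 : (l : L) ≠ 0) (hpl : p ∣ l) {c a : L} (hc : 1 < ‖c‖)
    (hlc : ‖(l : L)‖ ^ l * ‖c‖ ^ (l - 1) < 1) {E : Subfield L} (hE : tree l c a 0 ⊆ E) :
    HasWildSeq p E := by
  have hln : l ≠ 0 := by omega
  obtain ⟨N, hN⟩ := exists_forall_mem_tree_norm_pow_eq hl hc a
  obtain ⟨ρ, hρ⟩ := IsAlgClosed.exists_pow_nat_eq c (Nat.pos_of_ne_zero hln)
  have hnorm : ∀ z ∈ tree l c a N, ‖z‖ = ‖ρ‖ := fun z hz =>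
    eq_of_pow_eq_of_nonneg hln (norm_nonneg _) (norm_nonneg _) (by rw [hN z hz, ← norm_pow, hρ])
  have hlam : ‖(l : L)‖ * ‖ρ‖ ^ (l - 1) < 1 := by
    rw [← hρ, norm_pow, ← pow_mul, mul_comm l, pow_mul, ← mul_pow] at hlc
    exact lt_of_pow_lt_pow_left₀ l zero_le_one (by rwa [one_pow])
  obtain ⟨b, hb⟩ := exists_mem_tree hln c a (N + 1)
  have hbT : b ∈ tree l c a N := ⟨N + 1, by omega, hb⟩
  have hb0 : b ≠ 0 := by
    rintro rfl
    have := hN 0 hbT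
    rw [norm_zero, zero_pow hln] at this
    linarith
  obtain ⟨y, hy, hyb, hle⟩ := exists_pow_eq_pow_closest hl hl0 hb0
  have hyT : y ∈ tree l c a N := by
    refine mem_tree_of_map_mem ⟨N, le_rfl, ?_⟩
    rw [hy, ← hb, Function.iterate_succ_apply]
  refine hasWildSeq_of_pair hp hp1 hl0 hpl hlam.le ((tree_subset (Nat.zero_le N)).trans hE)
    (fun z => mem_tree_of_map_mem) hnorm hyT hbT hyb ?_
  rintro ⟨-, i, hi, hi'⟩
  have := hle i hi
  rw [hnorm b hbT, hi'] at this
  exact this.not_gt (mul_lt_of_lt_one_left (norm_pos_iff.2 (sub_ne_zero.2 hyb)) hlam)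

end Tree

/-! ### The contracting case with `|c| ≤ 1`. -/

section IntegralParameter

variable {L : Type*} [NormedField L]

theorem eval_sub_coeff_zero_eq_sum (g : L[X]) (h : L) :
    g.eval h - g.coeff 0 = ∑ i ∈ Finset.Icc 1 g.natDegree, g.coeff i * h ^ i := by
  rw [eval_eq_sum_range, Finset.sum_range_succ', pow_zero, mul_one, add_sub_cancel_right,
    Finset.range_eq_Ico, Finset.sum_Ico_add' (fun i => g.coeff i * h ^ i) 0 g.natDegree 1]
  rfl

variable [IsUltrametricDist L]

theorem norm_sum_eq_of_forall_lt {ι : Type*} {s : Finset ι} {f : ι → L} {j : ι}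
    (hj : j ∈ s) (h : ∀ i ∈ s, i ≠ j → ‖f i‖ < ‖f j‖) : ‖∑ i ∈ s, f i‖ = ‖f j‖ := by
  classical
  rw [← Finset.add_sum_erase s f hj]
  rcases (s.erase j).eq_empty_or_nonempty with he | he
  · simp [he]
  · obtain ⟨i, hi, hle⟩ := IsUltrametricDist.exists_norm_finsetSum_le_of_nonempty he f
    exact norm_add_eq_left (hle.trans_lt
      (h i (Finset.mem_of_mem_erase hi) (Finset.ne_of_mem_erase hi)))

theorem norm_lt_one_of_dvd {p l : ℕ} (hp1 : ‖(p : L)‖ < 1) (hpl : p ∣ l) : ‖(l : L)‖ < 1 := by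
  obtain ⟨k, rfl⟩ := hpl
  push_cast
  rw [norm_mul]
  exact mul_lt_one_of_nonneg_of_lt_one_left (norm_nonneg _) hp1
    (IsUltrametricDist.norm_natCast_le_one L k)

theorem norm_le_one_of_mem_tree {l : ℕ} (hl : l ≠ 0) {c a : L} (hc : ‖c‖ ≤ 1) (ha : ‖a‖ ≤ 1)
    {z : L} (hz : z ∈ tree l c a 0) : ‖z‖ ≤ 1 := by
  obtain ⟨n, -, hz⟩ := hz
  induction n generalizing z with
  | zero => rw [Function.iterate_zero, id] at hz; rwa [hz]
  | succ n ih =>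
    rw [Function.iterate_succ_apply] at hz
    have h1 := ih hz
    rw [← pow_le_one_iff_of_nonneg (norm_nonneg z) hl, ← norm_pow]
    have := IsUltrametricDist.norm_add_le_max (z ^ l - c) c
    rw [sub_add_cancel] at this
    exact this.trans (max_le h1 hc)

/-- Points of norm greater than one lead to wild ramification when `|c| ≤ 1`. -/
theorem hasWildSeq_of_one_lt_norm_point [IsAlgClosed L] {p l : ℕ} (hl : l ≠ 0) (hpl : p ∣ l)
    {c a : L} (hc : ‖c‖ ≤ 1) (ha : 1 < ‖a‖) {E : Subfield L} (hE : tree l c a 0 ⊆ E) :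
    HasWildSeq p E := by
  obtain ⟨z, hz0, hz⟩ := exists_backward_orbit hl c a
  have hone : ∀ n, 1 < ‖z n‖ ∧ ‖z n‖ = ‖z (n + 1)‖ ^ l := by
    have key : ∀ n, 1 < ‖z n‖ → ‖z n‖ = ‖z (n + 1)‖ ^ l := fun n hn => by
      rw [← norm_pow, ← norm_add_eq_left (hc.trans_lt hn), ← hz n, sub_add_cancel]
    intro n
    induction n with
    | zero => rw [← hz0] at ha; exact ⟨ha, key 0 ha⟩
    | succ n ih =>
      have : 1 < ‖z (n + 1)‖ := by
        rw [← one_lt_pow_iff_of_nonneg (norm_nonneg _) hl, ← ih.2]; exact ih.1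
      exact ⟨this, key _ this⟩
  refine ⟨z, fun _ => l, fun n => hE ⟨n, Nat.zero_le _, ?_⟩, ?_, (hone 0).1.ne',
    fun n => ⟨hpl, (hone n).2⟩⟩
  · simpa [hz0] using iterate_backward_orbit hz n 0
  · exact norm_pos_iff.1 (zero_lt_one.trans (hone 0).1)

/-- A point of the open unit disk that is farther from the origin than `f^s(0)` leads to wild
ramification. -/
theorem hasWildSeq_of_escape [IsAlgClosed L] {p l : ℕ} (hl : 2 ≤ l) (hpl : p ∣ l)
    {c a : L} (hc : ‖c‖ ≤ 1) {s : ℕ} {w : L} (hw : w ∈ tree l c a 0)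
    (hw0 : ‖(fun z => z ^ l - c)^[s + 1] 0‖ < ‖w‖) (hw1 : ‖w‖ < 1)
    {E : Subfield L} (hE : tree l c a 0 ⊆ E) : HasWildSeq p E := by
  have hln : l ≠ 0 := by omega
  set g := iteratePoly l c (s + 1) with hg
  have hmon : g.Monic := monic_iteratePoly hln c _
  have hdeg : g.natDegree = l ^ (s + 1) := natDegree_iteratePoly l c _
  have hdeg0 : g.natDegree ≠ 0 := by rw [hdeg]; positivity
  have hco : ∀ i, ‖g.coeff i‖ ≤ 1 := norm_coeff_iteratePoly_le_one hc l _
  have hg0 : g.coeff 0 = (fun z => z ^ l - c)^[s + 1] 0 := by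
    rw [coeff_zero_eq_eval_zero, hg, eval_iteratePoly]
  set ε := ‖g.coeff 0‖ with hε
  rw [← hg0] at hw0
  obtain ⟨j, hj, hj1, μ, hμ0, hμ1, hdom⟩ := exists_dominant_index hdeg0
    (fun i => norm_nonneg (g.coeff i)) hco (by simp [hmon.coeff_natDegree])
  have hval : ∀ x h : L, ε < ‖x‖ → g.eval h = x → ‖x‖ = ‖g.eval h - g.coeff 0‖ := by
    intro x h hx hh
    rw [hh, sub_eq_add_neg, norm_add_eq_left (by rwa [norm_neg])]
  -- Only exponents divisible by `l ≥ 2` occur, so preimages in the open disk move outwards at least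
  -- as fast as square roots.
  have hsq : ∀ x h : L, ε < ‖x‖ → ‖h‖ < 1 → g.eval h = x → ‖x‖ ≤ ‖h‖ ^ 2 := by
    intro x h hx hh1 hh
    rw [hval x h hx hh, eval_sub_coeff_zero_eq_sum]
    refine IsUltrametricDist.norm_sum_le_of_forall_le_of_nonneg (by positivity) fun i hi => ?_
    by_cases hli : l ∣ i
    · have : 2 ≤ i := hl.trans (Nat.le_of_dvd (by have := (Finset.mem_Icc.1 hi).1; omega) hli)
      rw [norm_mul, norm_pow]
      exact (mul_le_of_le_one_left (by positivity) (hco i)).trans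
        (pow_le_pow_of_le_one (norm_nonneg _) hh1.le this)
    · rw [hg, coeff_iteratePoly_eq_zero (by omega) c s hli, zero_mul, norm_zero]
      positivity
  have hnext : ∀ x : {x : L // x ∈ tree l c a 0 ∧ ε < ‖x‖ ∧ ‖x‖ < 1},
      ∃ h : {x : L // x ∈ tree l c a 0 ∧ ε < ‖x‖ ∧ ‖x‖ < 1}, g.eval h.1 = x.1 := by
    rintro ⟨x, hxT, hx0, hx1⟩
    have hcx : (g - C x).coeff 0 = g.coeff 0 - x := by simp
    have hcn : ‖g.coeff 0 - x‖ = ‖x‖ := by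
      rw [norm_sub_rev, sub_eq_add_neg, norm_add_eq_left (by rwa [norm_neg])]
    have hxpos : 0 < ‖x‖ := (norm_nonneg _).trans_lt hx0
    obtain ⟨h, hh, hle, -⟩ := exists_root_dominant (g := g - C x)
      (by rw [hcx, ← norm_ne_zero_iff, hcn]; exact hxpos.ne') (by rwa [natDegree_sub_C])
    have hhx : g.eval h = x := by simpa [sub_eq_zero] using hh
    -- The leading monomial is monic and bounded by the constant term, whose norm is `|x| < 1`.
    have hh1 : ‖h‖ < 1 := by
      have := hle g.natDegree
      rw [coeff_sub, coeff_C_of_ne_zero hdeg0, hmon.coeff_natDegree, sub_zero, norm_one, one_mul, hcx,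
        hcn] at this
      exact (pow_lt_one_iff_of_nonneg (norm_nonneg _) hdeg0).1 (this.trans_lt hx1)
    refine ⟨⟨h, mem_tree_of_iterate_mem (s + 1) ?_, ?_, hh1⟩, hhx⟩
    · rw [← eval_iteratePoly, ← hg, hhx]; exact hxT
    · refine hx0.trans_le ((hsq x h hx0 hh1 hhx).trans ?_)
      rw [sq]
      exact mul_le_of_le_one_left (norm_nonneg _) hh1.le
  choose nx hnx using hnext
  set q : ℕ → {x : L // x ∈ tree l c a 0 ∧ ε < ‖x‖ ∧ ‖x‖ < 1} := fun n => nx^[n] ⟨w, hw, hw0, hw1⟩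
  have hq : ∀ n, g.eval (q (n + 1)).1 = (q n).1 := fun n => by
    simp only [q, Function.iterate_succ_apply']; exact hnx _
  obtain ⟨N, hN⟩ := exists_forall_lt_of_le_max (r := fun n => ‖(q n).1‖) zero_lt_one
    (fun n => (norm_nonneg _).trans_lt (q n).2.2.1) (fun n => (q n).2.2.2)
    (fun n => le_max_of_le_right (hsq _ _ (q n).2.2.1 (q (n + 1)).2.2.2 (hq n))) hμ1
  -- Beyond `N` the norms exceed `μ`, so the monomial of degree `j` alone gives the norm; its
  -- coefficient is nonzero, hence `l ∣ j`.
  refine ⟨fun n => (q (N + n)).1, fun _ => j, fun n => hE (q _).2.1,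
    norm_pos_iff.1 ((norm_nonneg _).trans_lt (q _).2.2.1), (q _).2.2.2.ne, fun n => ⟨?_, ?_⟩⟩
  · refine hpl.trans ?_
    by_contra hlj
    rw [hg, coeff_iteratePoly_eq_zero (by omega) c s hlj, norm_zero] at hj1
    exact zero_ne_one hj1
  · rw [hval _ _ (q (N + n)).2.2.1 (hq (N + n)), eval_sub_coeff_zero_eq_sum,
      norm_sum_eq_of_forall_lt hj, norm_mul, hj1, one_mul, norm_pow]
    · rfl
    · intro i hi hij
      rw [norm_mul, norm_mul, hj1, one_mul, norm_pow, norm_pow]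
      exact hdom _ (hN _ (by omega)) (q _).2.2.2 i hi hij

/-- Exponents prime to `p` carry a coefficient of norm at most `|l|`; all others are at least `2`.
-/
theorem isMaxMonomial_le_max {p l : ℕ} (hp : p.Prime) (hp1 : ‖(p : L)‖ < 1) {R r s : ℝ}
    (hR0 : 0 ≤ R) (hR : R ≤ 1) (hr0 : 0 ≤ r) (hr : r ≤ 1)
    (h : IsMaxMonomial l (binomialSize L l R) r s) : s ≤ max (‖(l : L)‖ * r) (r ^ 2) := by
  obtain ⟨i, hi, rfl⟩ := h.2
  have hi1 := (Finset.mem_Icc.1 hi).1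
  have hRi : R ^ (l - i) ≤ 1 := pow_le_one₀ hR0 hR
  unfold binomialSize
  by_cases hpi : p ∣ i
  · refine le_max_of_le_right ?_
    have h2 : 2 ≤ i := hp.two_le.trans (Nat.le_of_dvd hi1 hpi)
    calc _ ≤ 1 * 1 * r ^ i := by
          gcongr
          exact IsUltrametricDist.norm_natCast_le_one L _
      _ ≤ r ^ 2 := by rw [one_mul, one_mul]; exact pow_le_pow_of_le_one hr0 hr h2
  · refine le_max_of_le_left ?_
    calc _ ≤ ‖(l : L)‖ * 1 * r ^ 1 := by
          gcongr ?_ * ?_ * ?_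
          · exact norm_choose_le hp hp1 hpi
          · exact pow_le_pow_of_le_one hr0 hr hi1
      _ = _ := by rw [mul_one, pow_one]

/-- A backward orbit inside the union of the unit circle and a smaller disk leads to wild
ramification. -/
theorem hasWildSeq_of_backward_orbit [IsAlgClosed L] {p : ℕ} (hp : p.Prime)
    (hp1 : ‖(p : L)‖ < 1) {l : ℕ} (hl : 2 ≤ l) (hl0 : (l : L) ≠ 0) (hpl : p ∣ l) {c a : L}
    (hc0 : c ≠ 0) {z : ℕ → L} (hzT : ∀ n, z n ∈ tree l c a 0)
    (hz : ∀ n, z (n + 1) ^ l - c = z n) {ε : ℝ} (hε : ε < 1)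
    (hzε : ∀ n, ‖z n‖ = 1 ∨ ‖z n‖ ≤ ε) {E : Subfield L} (hE : tree l c a 0 ⊆ E) :
    HasWildSeq p E := by
  have hln : l ≠ 0 := by omega
  have hl1 := norm_lt_one_of_dvd hp1 hpl
  have hz1 : ∀ n, ‖z n‖ ≤ 1 := fun n => (hzε n).elim (fun h => h.le) fun h => h.trans hε.le
  -- Two consecutive zeros in the orbit would force `c = 0`.
  obtain ⟨m, hm⟩ : ∃ m, z (m + 1) ≠ 0 := by
    by_contra! h
    have := hz 1
    rw [h 0, h 1, zero_pow hln, zero_sub, neg_eq_zero] at this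
    exact hc0 this
  obtain ⟨y, hy, hyz, hyle⟩ := exists_pow_eq_pow_closest hl hl0 hm
  have hyT : y ∈ tree l c a 0 := mem_tree_of_map_mem (by rw [hy, hz]; exact hzT m)
  have hy1 : ‖y - z (m + 1)‖ < 1 := by
    have h1 := hyle l (Finset.mem_Icc.2 ⟨by omega, le_rfl⟩)
    have hpos : 0 < ‖y - z (m + 1)‖ := norm_pos_iff.2 (sub_ne_zero.2 hyz)
    by_contra! hge
    unfold binomialSize at h1
    simp only [Nat.choose_self, Nat.cast_one, norm_one, Nat.sub_self, pow_zero, one_mul] at h1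
    have h2 : ‖y - z (m + 1)‖ ^ 1 ≤ ‖y - z (m + 1)‖ ^ l := pow_le_pow_right₀ hge (by omega)
    rw [pow_one] at h2
    have h3 : ‖(l : L)‖ * ‖z (m + 1)‖ ^ (l - 1) < 1 :=
      mul_lt_one_of_nonneg_of_lt_one_left (norm_nonneg _) hl1 (pow_le_one₀ (norm_nonneg _) (hz1 _))
    exact (h2.trans h1).not_gt (mul_lt_of_lt_one_left hpos h3)
  have hnext : ∀ n (x : {x : L // x ∈ tree l c a 0 ∧ x ≠ z n ∧ ‖x - z n‖ < 1}),
      ∃ x' : {x : L // x ∈ tree l c a 0 ∧ x ≠ z (n + 1) ∧ ‖x - z (n + 1)‖ < 1},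
        IsMaxMonomial l (binomialSize L l ‖z (n + 1)‖) ‖x'.1 - z (n + 1)‖ ‖x.1 - z n‖ := by
    rintro n ⟨x, hxT, hxz, hx1⟩
    have hzc : z (n + 1) ^ l = z n + c := by rw [← hz n, sub_add_cancel]
    obtain ⟨t, ht, htz, hmax⟩ := exists_pow_eq_isMaxMonomial (l := l) hln (b := z (n + 1))
      (w := x + c) (by rw [hzc]; exact fun h => hxz (add_right_cancel h).symm)
    rw [hzc, add_sub_add_right_eq_sub, norm_sub_rev (z n)] at hmax
    refine ⟨⟨t, mem_tree_of_map_mem (by rwa [ht, add_sub_cancel_right]), htz, ?_⟩, hmax⟩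
    have := hmax.1 l (Finset.mem_Icc.2 ⟨by omega, le_rfl⟩)
    unfold binomialSize at this
    simp only [Nat.choose_self, Nat.cast_one, norm_one, Nat.sub_self, pow_zero, one_mul] at this
    exact (pow_lt_one_iff_of_nonneg (norm_nonneg _) hln).1 (this.trans_lt hx1)
  choose nx hnx using hnext
  let q : ∀ n, {x : L // x ∈ tree l c a 0 ∧ x ≠ z (m + 1 + n) ∧ ‖x - z (m + 1 + n)‖ < 1} :=
    fun n => Nat.rec ⟨y, hyT, hyz, hy1⟩ (fun k x => nx (m + 1 + k) x) n
  have hq : ∀ n, IsMaxMonomial l (binomialSize L l ‖z (m + 1 + (n + 1))‖)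
      ‖(q (n + 1)).1 - z (m + 1 + (n + 1))‖ ‖(q n).1 - z (m + 1 + n)‖ := fun n => hnx _ (q n)
  set r : ℕ → ℝ := fun n => ‖(q n).1 - z (m + 1 + n)‖ with hr
  have hr0 : ∀ n, 0 < r n := fun n => norm_pos_iff.2 (sub_ne_zero.2 (q n).2.2.1)
  have hr1 : ∀ n, r n < 1 := fun n => (q n).2.2.2
  obtain ⟨j, hj, hj1, μ, hμ0, hμ1, hdom⟩ := exists_dominant_index hln
    (a := fun i => ‖((l.choose i : ℕ) : L)‖) (fun i => norm_nonneg _)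
    (fun i => IsUltrametricDist.norm_natCast_le_one L _) (by simp)
  -- A second threshold, for base points of norm at most `ε`: beyond it `r ^ l > ε`, so the monomial
  -- of degree `l` beats those with a positive power of the base point.
  obtain ⟨μ', hμ0', hμ1', hμ'⟩ := exists_lt_one_forall_lt_pow hε l
  obtain ⟨N, hN⟩ := exists_forall_lt_of_le_max (r := r) hl1 hr0 hr1
    (fun n => isMaxMonomial_le_max hp hp1 (norm_nonneg _) (hz1 _) (hr0 (n + 1)).le
      (hr1 (n + 1)).le (hq n))
    (max_lt hμ1 hμ1')
  have hpj : p ∣ j := by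
    by_contra h
    have := norm_choose_le (L := L) hp hp1 (l := l) h
    rw [hj1] at this
    exact this.not_gt hl1
  have hrec : ∀ n, ∃ d, N ≤ n → p ∣ d ∧ r n = r (n + 1) ^ d := by
    intro n
    by_cases hNn : N ≤ n
    swap
    -- The value below `N` is never used.
    · exact ⟨0, fun h => absurd h hNn⟩
    have hμr := hN (n + 1) (by omega)
    obtain ⟨i, hi, hie⟩ := (hq n).2
    rcases hzε (m + 1 + (n + 1)) with h | h
    · refine ⟨j, fun _ => ⟨hpj, ?_⟩⟩
      have hle := (hq n).1 j hj
      rw [h] at hle hie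
      simp only [binomialSize, one_pow, mul_one] at hle hie hj1
      rw [hj1, one_mul] at hle
      by_cases hij : i = j
      · rw [hij, hj1, one_mul] at hie; exact hie.symm
      · refine absurd hle (not_le.2 ?_)
        rw [← hie]
        exact hdom _ ((le_max_left _ _).trans_lt hμr) (hr1 (n + 1)) i hi hij
    · refine ⟨l, fun _ => ⟨hpl, ?_⟩⟩
      have hle := (hq n).1 l (Finset.mem_Icc.2 ⟨by omega, le_rfl⟩)
      unfold binomialSize at hle hie
      simp only [Nat.choose_self, Nat.cast_one, norm_one, Nat.sub_self, pow_zero, one_mul] at hle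
      by_cases hil : i = l
      · rw [hil, Nat.choose_self, Nat.sub_self, Nat.cast_one, norm_one, pow_zero, one_mul,
          one_mul] at hie
        exact hie.symm
      · refine absurd hle (not_le.2 ?_)
        rw [← hie]
        have hil' : l - i ≠ 0 := by have := (Finset.mem_Icc.1 hi).2; omega
        calc _ ≤ 1 * ‖z (m + 1 + (n + 1))‖ ^ (l - i) * 1 := by
              gcongr
              · exact IsUltrametricDist.norm_natCast_le_one L _
              · exact pow_le_one₀ (norm_nonneg _) (hr1 (n + 1)).le
          _ = ‖z (m + 1 + (n + 1))‖ ^ (l - i) := by ring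
          _ ≤ ‖z (m + 1 + (n + 1))‖ := pow_le_of_le_one (norm_nonneg _) (hz1 _) hil'
          _ ≤ ε := h
          _ < _ := hμ' _ ((le_max_right _ _).trans_lt hμr) (hr1 (n + 1))
  choose d hd using hrec
  refine ⟨fun n => (q (N + n)).1 - z (m + 1 + (N + n)), fun n => d (N + n),
    fun n => E.sub_mem (hE (q _).2.1) (hE (hzT _)), sub_ne_zero.2 (q _).2.2.1, (hr1 _).ne,
    fun n => hd (N + n) (by omega)⟩

theorem norm_iterate_sub_le {l : ℕ} {c x : L} (hc : ‖c‖ ≤ 1) (hx : ‖x‖ ≤ 1) (s : ℕ) :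
    ‖(fun z => z ^ l - c)^[s] x - (fun z => z ^ l - c)^[s] 0‖ ≤ ‖x‖ := by
  rw [← eval_iteratePoly, ← eval_iteratePoly, ← coeff_zero_eq_eval_zero,
    eval_sub_coeff_zero_eq_sum]
  refine IsUltrametricDist.norm_sum_le_of_forall_le_of_nonneg (norm_nonneg _) fun i hi => ?_
  rw [norm_mul, norm_pow]
  exact (mul_le_of_le_one_left (by positivity) (norm_coeff_iteratePoly_le_one hc l s i)).trans
    (pow_le_of_le_one (norm_nonneg _) hx (by have := (Finset.mem_Icc.1 hi).1; omega))

/-- The critical orbit decides. If some `f^(s+1)(0)` lies in the open unit disk, either a tree point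
there is farther from the origin, or every point of a backward orbit has norm one or at most
`|f^(s+1)(0)|`. If none does, a backward orbit meets the open disk at most once. -/
theorem hasWildSeq_of_norm_le_one [IsAlgClosed L] {p : ℕ} (hp : p.Prime) (hp1 : ‖(p : L)‖ < 1)
    {l : ℕ} (hl : 2 ≤ l) (hl0 : (l : L) ≠ 0) (hpl : p ∣ l) {c a : L} (hc0 : c ≠ 0)
    (hc : ‖c‖ ≤ 1) {E : Subfield L} (hE : tree l c a 0 ⊆ E) : HasWildSeq p E := by
  have hln : l ≠ 0 := by omega
  rcases lt_or_ge 1 ‖a‖ with ha | ha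
  · exact hasWildSeq_of_one_lt_norm_point hln hpl hc ha hE
  obtain ⟨z, hz0, hz⟩ := exists_backward_orbit hln c a
  have hzT : ∀ n, z n ∈ tree l c a 0 := fun n =>
    ⟨n, Nat.zero_le _, by simpa [hz0] using iterate_backward_orbit hz n 0⟩
  have hz1 : ∀ n, ‖z n‖ ≤ 1 := fun n => norm_le_one_of_mem_tree hln hc ha (hzT n)
  by_cases hs : ∃ s, ‖(fun z => z ^ l - c)^[s + 1] 0‖ < 1
  · obtain ⟨s, hs⟩ := hs
    by_cases hw : ∃ w ∈ tree l c a 0, ‖(fun z => z ^ l - c)^[s + 1] 0‖ < ‖w‖ ∧ ‖w‖ < 1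
    · obtain ⟨w, hwT, h1, h2⟩ := hw
      exact hasWildSeq_of_escape hl hpl hc hwT h1 h2 hE
    · push Not at hw
      refine hasWildSeq_of_backward_orbit hp hp1 hl hl0 hpl hc0 hzT hz hs (fun n => ?_) hE
      by_cases h : ‖(fun z => z ^ l - c)^[s + 1] 0‖ < ‖z n‖
      · exact Or.inl (le_antisymm (hz1 n) (hw _ (hzT n) h))
      · exact Or.inr (not_lt.1 h)
  · push Not at hs
    -- The iterates are integral polynomials, so two visits to the open disk would bring
    -- `f^(k+1)(0)` into it.
    have honce : ∀ n k, ‖z n‖ < 1 → ¬ ‖z (n + (k + 1))‖ < 1 := by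
      intro n k h1 h2
      have h3 := norm_iterate_sub_le (l := l) hc (hz1 (n + (k + 1))) (k + 1)
      rw [iterate_backward_orbit hz] at h3
      have h4 := norm_sub_le_max (z n) (z n - (fun z => z ^ l - c)^[k + 1] 0)
      rw [sub_sub_cancel] at h4
      exact (h4.trans_lt (max_lt h1 (h3.trans_lt h2))).not_ge (hs k)
    obtain ⟨N, hN⟩ : ∃ N, ∀ n, ‖z (N + n)‖ = 1 := by
      by_cases h : ∃ n, ‖z n‖ < 1
      · obtain ⟨m, hm⟩ := h
        refine ⟨m + 1, fun n => le_antisymm (hz1 _) (not_lt.1 ?_)⟩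
        have := honce m n hm
        rwa [show m + 1 + n = m + (n + 1) by ring]
      · push Not at h
        exact ⟨0, fun n => le_antisymm (hz1 _) (h _)⟩
    exact hasWildSeq_of_backward_orbit hp hp1 hl hl0 hpl hc0 (z := fun n => z (N + n))
      (fun n => hzT _) (fun n => hz (N + n)) zero_lt_one (fun n => Or.inl (hN n)) hE

end IntegralParameter

/-! ### The expanding case: Krasner approximation. -/

section Expanding

variable {L : Type*} [NormedField L]

theorem pow_sub_pow_eq_sum (l : ℕ) (x y : L) : y ^ l - x ^ l =
    ∑ i ∈ Finset.Icc 1 l, ((X + C x) ^ l - C 0).coeff i * (y - x) ^ i := by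
  have h := eval_sub_coeff_zero_eq_sum ((X + C x) ^ l - C 0) (y - x)
  rw [natDegree_sub_C, natDegree_pow, natDegree_X_add_C, mul_one] at h
  rw [← h]
  simp [coeff_zero_eq_eval_zero]

theorem binomialSize_one (l : ℕ) (R : ℝ) : binomialSize L l R 1 = ‖(l : L)‖ * R ^ (l - 1) := by
  rw [binomialSize, Nat.choose_one_right]

theorem binomialSize_self (l : ℕ) (R : ℝ) : binomialSize L l R l = 1 := by
  simp [binomialSize]

theorem one_lt_norm_of_le {l : ℕ} (hl : l ≠ 0) (hl1 : ‖(l : L)‖ < 1) {c : L}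
    (h : 1 ≤ ‖(l : L)‖ ^ l * ‖c‖ ^ (l - 1)) : 1 < ‖c‖ := by
  by_contra! hc
  exact h.not_gt (mul_lt_one_of_nonneg_of_lt_one_left (by positivity)
    (pow_lt_one₀ (norm_nonneg _) hl1 hl) (pow_le_one₀ (norm_nonneg _) hc))

variable [IsUltrametricDist L]

theorem norm_pow_sub_pow_le {l : ℕ} {x y : L} {s : ℝ} (hs : 0 ≤ s)
    (h : ∀ i ∈ Finset.Icc 1 l, binomialSize L l ‖x‖ i * ‖y - x‖ ^ i ≤ s) :
    ‖y ^ l - x ^ l‖ ≤ s := by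
  rw [pow_sub_pow_eq_sum]
  refine IsUltrametricDist.norm_sum_le_of_forall_le_of_nonneg hs fun i hi => ?_
  rw [norm_mul, norm_pow, coeff_X_add_C_pow_sub_C _ _ _ (by have := (Finset.mem_Icc.1 hi).1; omega)]
  exact h i hi

theorem norm_pow_sub_pow_eq {l j : ℕ} {x y : L} (hj : j ∈ Finset.Icc 1 l)
    (h : ∀ i ∈ Finset.Icc 1 l, i ≠ j → binomialSize L l ‖x‖ i * ‖y - x‖ ^ i <
      binomialSize L l ‖x‖ j * ‖y - x‖ ^ j) :
    ‖y ^ l - x ^ l‖ = binomialSize L l ‖x‖ j * ‖y - x‖ ^ j := by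
  have hn : ∀ i ∈ Finset.Icc 1 l, ‖((X + C x) ^ l - C 0).coeff i * (y - x) ^ i‖ =
      binomialSize L l ‖x‖ i * ‖y - x‖ ^ i := fun i hi => by
    rw [norm_mul, norm_pow,
      coeff_X_add_C_pow_sub_C _ _ _ (by have := (Finset.mem_Icc.1 hi).1; omega)]
  rw [pow_sub_pow_eq_sum, norm_sum_eq_of_forall_lt hj, hn j hj]
  intro i hi hij
  rw [hn i hi, hn j hj]
  exact h i hi hij

/-- On a circle of radius at least one, `z ↦ z ^ l` scales small distances by `|l| R ^ (l - 1)`. -/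
theorem exists_norm_pow_sub_pow_eq_mul {l : ℕ} (hl : l ≠ 0) (hl0 : (l : L) ≠ 0) {R : ℝ}
    (hR : 1 ≤ R) : ∃ δ > 0, ∀ x y : L, ‖x‖ = R → ‖y - x‖ < δ →
      ‖y ^ l - x ^ l‖ = ‖(l : L)‖ * R ^ (l - 1) * ‖y - x‖ := by
  have hRpos : 0 < R := by linarith
  have hlpos := norm_pos_iff.2 hl0
  -- Below distance one the terms of degree at least two are at most `R^l |y - x|^2`; the second
  -- bound makes this smaller than the linear term.
  refine ⟨min 1 (‖(l : L)‖ * R ^ (l - 1) / R ^ l), by positivity, fun x y hx hxy => ?_⟩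
  rw [← binomialSize_one, ← pow_one ‖y - x‖, ← hx]
  by_cases hyx : y = x
  · simp [hyx]
  have hpos : 0 < ‖y - x‖ := norm_pos_iff.2 (sub_ne_zero.2 hyx)
  refine norm_pow_sub_pow_eq (Finset.mem_Icc.2 ⟨le_rfl, by omega⟩) fun i hi hi1 => ?_
  have h1 : ‖y - x‖ < 1 := hxy.trans_le (min_le_left _ _)
  have h2 := hxy.trans_le (min_le_right _ _)
  rw [lt_div_iff₀ (by positivity)] at h2
  rw [binomialSize_one, pow_one, hx]
  have hi2 : 2 ≤ i := by have := (Finset.mem_Icc.1 hi).1; omega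
  calc binomialSize L l R i * ‖y - x‖ ^ i ≤ 1 * R ^ l * ‖y - x‖ ^ 2 := by
        unfold binomialSize
        gcongr ?_ * ?_ * ?_
        · exact IsUltrametricDist.norm_natCast_le_one L _
        · exact pow_le_pow_right₀ hR (by omega)
        · exact pow_le_pow_of_le_one (norm_nonneg _) h1.le hi2
    _ = ‖y - x‖ * R ^ l * ‖y - x‖ := by ring
    _ < _ := mul_lt_mul_of_pos_right h2 hpos

/-- In the expanding range, every point of high level is approximated by a point of the preceding
level better than by its own conjugates. -/
theorem exists_krasner_approximation [IsAlgClosed L] {l : ℕ} (hl : 2 ≤ l) (hl0 : (l : L) ≠ 0)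
    (hl1 : ‖(l : L)‖ < 1) {c a : L} (hlc : 1 < ‖(l : L)‖ ^ l * ‖c‖ ^ (l - 1)) :
    ∃ M, ∀ n, M ≤ n → ∀ b, (fun z => z ^ l - c)^[n + 1] b = a →
      ∃ b', (fun z => z ^ l - c)^[n] b' = a ∧
        ∀ y, y ^ l = b ^ l → y ≠ b → ‖b' - b‖ < ‖y - b‖ := by
  have hln : l ≠ 0 := by omega
  have hc := one_lt_norm_of_le hln hl1 hlc.le
  obtain ⟨N, hN⟩ := exists_forall_mem_tree_norm_pow_eq hl hc a
  obtain ⟨ρ, hρ⟩ := IsAlgClosed.exists_pow_nat_eq c (Nat.pos_of_ne_zero hln)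
  have hnorm : ∀ z ∈ tree l c a N, ‖z‖ = ‖ρ‖ := fun z hz =>
    eq_of_pow_eq_of_nonneg hln (norm_nonneg _) (norm_nonneg _) (by rw [hN z hz, ← norm_pow, hρ])
  set lam := ‖(l : L)‖ * ‖ρ‖ ^ (l - 1) with hlamdef
  have hlam : 1 < lam := by
    rw [← hρ, norm_pow, ← pow_mul, mul_comm l, pow_mul, ← mul_pow] at hlc
    exact lt_of_pow_lt_pow_left₀ l (by positivity) (by rwa [one_pow])
  have hρ1 : 1 < ‖ρ‖ := by
    rw [← one_lt_pow_iff_of_nonneg (norm_nonneg _) hln, ← norm_pow, hρ]; exact hc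
  obtain ⟨δ, hδ, hiso⟩ := exists_norm_pow_sub_pow_eq_mul hln hl0 hρ1.le
  -- Newton's estimate for `f^k` will give distance at most `R / λ^k`; this `k` brings it below `δ`,
  -- the injectivity radius of `z ↦ z ^ l`.
  obtain ⟨k, hk⟩ := pow_unbounded_of_one_lt (‖ρ‖ / δ) hlam
  have hder : ∀ j b, (∃ n, N + j ≤ n ∧ (fun z => z ^ l - c)^[n] b = a) →
      ‖(iteratePoly l c j).derivative.eval b‖ = lam ^ j := by
    intro j
    induction j with
    | zero => intro b _; simp [iteratePoly]
    | succ j ih =>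
      rintro b ⟨n, hn, hb⟩
      have hbT : b ∈ tree l c a N := ⟨n, by omega, hb⟩
      obtain ⟨m, rfl⟩ : ∃ m, n = m + 1 := ⟨n - 1, by omega⟩
      rw [Function.iterate_succ_apply] at hb
      rw [eval_derivative_iteratePoly_succ, norm_mul, ih _ ⟨m, by omega, hb⟩, norm_mul, norm_pow,
        hnorm b hbT, pow_succ']
  refine ⟨N + k, fun n hn b hb => ?_⟩
  obtain ⟨m, rfl⟩ : ∃ m, n = m + k := ⟨n - k, by omega⟩
  obtain ⟨w, hw⟩ := exists_mem_tree hln c a m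
  obtain ⟨b', hb', hle⟩ := exists_eval_eq_norm_derivative_mul_le (g := iteratePoly l c k)
    (by rw [natDegree_iteratePoly]; positivity) b w
  rw [eval_iteratePoly] at hb' hle
  have hbT : b ∈ tree l c a N := ⟨m + k + 1, by omega, hb⟩
  refine ⟨b', by rw [Function.iterate_add_apply, hb', hw], fun y hy hyb => ?_⟩
  have hδy : δ ≤ ‖y - b‖ := by
    by_contra! hlt
    have h1 := hiso b y (hnorm b hbT) hlt
    rw [hy, sub_self, norm_zero] at h1
    have : 0 < lam * ‖y - b‖ := mul_pos (by linarith) (norm_pos_iff.2 (sub_ne_zero.2 hyb))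
    exact this.ne h1
  refine lt_of_lt_of_le ?_ hδy
  rw [hder k b ⟨m + k + 1, by omega, hb⟩] at hle
  have hfb : (fun z => z ^ l - c)^[k] b ∈ tree l c a N :=
    ⟨m + 1, by omega, by rw [← Function.iterate_add_apply, show m + 1 + k = m + k + 1 by ring, hb]⟩
  have hwT : w ∈ tree l c a N := ⟨m, by omega, hw⟩
  have hR : ‖(fun z => z ^ l - c)^[k] b - w‖ ≤ ‖ρ‖ := by
    refine (norm_sub_le_max _ _).trans ?_
    rw [hnorm _ hfb, hnorm _ hwT, max_self]
  rw [div_lt_iff₀ hδ] at hk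
  have : lam ^ k * ‖b' - b‖ < lam ^ k * δ := (hle.trans hR).trans_lt hk
  exact lt_of_mul_lt_mul_left this (by positivity)

end Expanding

/-! ### The boundary case `λ = 1`. -/

section Boundary

variable {L : Type*} [NormedField L]

/-- The common data of the boundary case: `R = |c| ^ (1 / l)` satisfies `|l| R ^ (l - 1) = 1`. -/
theorem exists_boundary_radius [IsAlgClosed L] {l : ℕ} (hl : 2 ≤ l) (hl1 : ‖(l : L)‖ < 1) {c : L}
    (hlc : ‖(l : L)‖ ^ l * ‖c‖ ^ (l - 1) = 1) :
    ∃ R : ℝ, 1 < R ∧ R ^ l = ‖c‖ ∧ ‖(l : L)‖ * R ^ (l - 1) = 1 := by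
  have hln : l ≠ 0 := by omega
  have hc := one_lt_norm_of_le hln hl1 hlc.ge
  obtain ⟨ρ, hρ⟩ := IsAlgClosed.exists_pow_nat_eq c (Nat.pos_of_ne_zero hln)
  refine ⟨‖ρ‖, ?_, by rw [← norm_pow, hρ], ?_⟩
  · rw [← one_lt_pow_iff_of_nonneg (norm_nonneg _) hln, ← norm_pow, hρ]; exact hc
  · rw [← hρ, norm_pow, ← pow_mul, mul_comm l, pow_mul, ← mul_pow] at hlc
    exact (pow_eq_one_iff_of_nonneg (by positivity) hln).1 hlc

variable [IsUltrametricDist L]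

/-- A distance `s > 1` is not fixed by the growth function, since the monomial of degree `l` already
gives `s^l > s`. -/
theorem hasWildSeq_of_one_lt_dist [IsAlgClosed L] {p : ℕ} (hp : p.Prime) (hp1 : ‖(p : L)‖ < 1)
    {l : ℕ} (hl : 2 ≤ l) (hl0 : (l : L) ≠ 0) (hpl : p ∣ l) {c a : L} {R : ℝ}
    (hlam : ‖(l : L)‖ * R ^ (l - 1) = 1) {N : ℕ} (hN : ∀ z ∈ tree l c a N, ‖z‖ = R)
    {E : Subfield L} (hE : tree l c a 0 ⊆ E) {z w : L} (hz : z ∈ tree l c a N)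
    (hw : w ∈ tree l c a N) (hzw : 1 < ‖z - w‖) : HasWildSeq p E := by
  refine hasWildSeq_of_pair hp hp1 hl0 hpl hlam.le ((tree_subset (Nat.zero_le N)).trans hE)
    (fun z => mem_tree_of_map_mem) hN hz hw ?_ fun h => ?_
  · rintro rfl
    rw [sub_self, norm_zero] at hzw
    linarith
  · have h1 := h.1 l (Finset.mem_Icc.2 ⟨by omega, le_rfl⟩)
    rw [binomialSize_self, one_mul] at h1
    have h2 : ‖z - w‖ ^ 1 < ‖z - w‖ ^ l := pow_lt_pow_right₀ hzw (by omega)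
    rw [pow_one] at h2
    exact h2.not_ge h1

theorem norm_eq_of_mem_tree_of_pow_eq {l : ℕ} (hl : 2 ≤ l) {c a : L} {R : ℝ} (hR : 1 < R)
    (hRc : R ^ l = ‖c‖) : ∃ N, ∀ z ∈ tree l c a N, ‖z‖ = R := by
  obtain ⟨N, hN⟩ := exists_forall_mem_tree_norm_pow_eq hl
    (by rw [← hRc]; exact one_lt_pow₀ hR (by omega)) a
  exact ⟨N, fun z hz => eq_of_pow_eq_of_nonneg (by omega : l ≠ 0) (norm_nonneg _) (by linarith)
    (by rw [hN z hz, hRc])⟩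

/-- If `l ≠ p`, some `l`-th root of unity is far from `1`. -/
theorem exists_pow_eq_one_one_lt [IsAlgClosed L] [CharZero L] {p : ℕ} (hp : p.Prime)
    (hp1 : ‖(p : L)‖ < 1) {l : ℕ} (hl : 2 ≤ l) (hlp : l ≠ p) (hpl : p ∣ l) {R : ℝ} (hR : 1 < R)
    (hlam : ‖(l : L)‖ * R ^ (l - 1) = 1) : ∃ ζ : L, ζ ^ l = 1 ∧ 1 < ‖1 - ζ‖ * R := by
  obtain ⟨n, rfl⟩ : ∃ n, l = n + 1 := ⟨l - 1, by omega⟩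
  by_contra! hcon
  have hne : NeZero ((n + 1 : ℕ) : L) := ⟨by exact_mod_cast n.succ_ne_zero⟩
  obtain ⟨ξ, hξ⟩ := HasEnoughRootsOfUnity.exists_primitiveRoot L (n + 1)
  have hξ1 : ∀ k, (ξ ^ k) ^ (n + 1) = 1 := fun k => by
    rw [← pow_mul, mul_comm, pow_mul, hξ.pow_eq_one, one_pow]
  -- The product of `1 - ξ^k` over `0 < k < l` is `l`, so after scaling each factor by `R` the
  -- product has norm one. If no factor exceeds one, all equal one.
  have hprod := congrArg norm hξ.prod_one_sub_pow_eq_order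
  rw [norm_prod] at hprod
  have hprod1 : ∏ k ∈ Finset.range n, (‖1 - ξ ^ (k + 1)‖ * R) = 1 := by
    rw [Finset.prod_mul_distrib, hprod, Finset.prod_const, Finset.card_range]
    simpa using hlam
  have hall : ∀ k ∈ Finset.range n, ‖1 - ξ ^ (k + 1)‖ * R = 1 := by
    by_contra! hex
    obtain ⟨k, hk, hk1⟩ := hex
    have hpos : ∀ i ∈ Finset.range n, 0 < ‖1 - ξ ^ (i + 1)‖ * R := fun i hi => by
      refine mul_pos (norm_pos_iff.2 (sub_ne_zero.2 fun h => ?_)) (by linarith)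
      exact hξ.pow_ne_one_of_pos_of_lt (by omega)
        (by have := Finset.mem_range.1 hi; omega) h.symm
    have := Finset.prod_lt_prod hpos (fun i _ => hcon _ (hξ1 (i + 1)))
      ⟨k, hk, (hcon _ (hξ1 (k + 1))).lt_of_ne hk1⟩
    rw [hprod1, Finset.prod_const_one] at this
    exact lt_irrefl _ this
  have hpn : p ≤ n := by
    have := Nat.le_of_dvd (by omega) hpl
    omega
  have h1 := hall 0 (Finset.mem_range.2 (by have := hp.pos; omega))
  have h2 := hall (p - 1) (Finset.mem_range.2 (by have := hp.pos; omega))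
  rw [Nat.sub_add_cancel hp.one_le] at h2
  rw [zero_add, pow_one] at h1
  have ht0 : 0 < ‖1 - ξ‖ := by
    by_contra! h
    rw [le_antisymm h (norm_nonneg _), zero_mul] at h1
    exact zero_ne_one h1
  have ht1 : ‖1 - ξ‖ < 1 := by
    by_contra! h
    nlinarith
  have heq : ‖1 - ξ ^ p‖ = ‖1 - ξ‖ := mul_right_cancel₀ (by linarith : R ≠ 0) (h2.trans h1.symm)
  -- Raising to the `p`-th power strictly contracts the distance to `1`, so the factors `k = 1` and
  -- `k = p` cannot be equal; `k = p` occurs because `p < l`.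
  have hlt : ‖ξ ^ p - 1 ^ p‖ ≤ max ‖(p : L)‖ ‖1 - ξ‖ * ‖1 - ξ‖ := by
    refine norm_pow_sub_pow_le (by positivity) fun i hi => ?_
    rw [norm_one, norm_sub_rev ξ 1]
    have hi1 := (Finset.mem_Icc.1 hi).1
    simp only [binomialSize, one_pow, mul_one]
    by_cases hpi : p ∣ i
    · have hi2 : 2 ≤ i := hp.two_le.trans (Nat.le_of_dvd hi1 hpi)
      calc _ ≤ 1 * ‖1 - ξ‖ ^ 2 := by
            gcongr ?_ * ?_
            · exact IsUltrametricDist.norm_natCast_le_one L _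
            · exact pow_le_pow_of_le_one (norm_nonneg _) ht1.le hi2
        _ = ‖1 - ξ‖ * ‖1 - ξ‖ := by ring
        _ ≤ _ := by gcongr; exact le_max_right _ _
    · calc _ ≤ ‖(p : L)‖ * ‖1 - ξ‖ ^ 1 := by
            gcongr ?_ * ?_
            · exact norm_choose_le hp hp1 hpi
            · exact pow_le_pow_of_le_one (norm_nonneg _) ht1.le hi1
        _ ≤ _ := by rw [pow_one]; gcongr; exact le_max_left _ _
  rw [one_pow, norm_sub_rev, heq] at hlt
  exact hlt.not_gt (mul_lt_of_lt_one_left ht0 (max_lt hp1 ht1))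

/-- Multiplying a point by a far root of unity `ζ` keeps its image and moves it by `|1 - ζ| R > 1`.
-/
theorem hasWildSeq_of_boundary_of_ne [IsAlgClosed L] [CharZero L] {p : ℕ} (hp : p.Prime)
    (hp1 : ‖(p : L)‖ < 1) {l : ℕ} (hl : 2 ≤ l) (hpl : p ∣ l) (hlp : l ≠ p) {c a : L}
    (hlc : ‖(l : L)‖ ^ l * ‖c‖ ^ (l - 1) = 1) {E : Subfield L} (hE : tree l c a 0 ⊆ E) :
    HasWildSeq p E := by
  have hln : l ≠ 0 := by omega
  obtain ⟨R, hR, hRc, hlam⟩ := exists_boundary_radius hl (norm_lt_one_of_dvd hp1 hpl) hlc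
  obtain ⟨N, hN⟩ := norm_eq_of_mem_tree_of_pow_eq hl (a := a) hR hRc
  obtain ⟨ζ, hζ, hζR⟩ := exists_pow_eq_one_one_lt hp hp1 hl hlp hpl hR hlam
  obtain ⟨b, hb⟩ := exists_mem_tree hln c a (N + 1)
  have hbT : b ∈ tree l c a N := ⟨N + 1, by omega, hb⟩
  have hyT : ζ * b ∈ tree l c a N := by
    refine mem_tree_of_map_mem ⟨N, le_rfl, ?_⟩
    rw [mul_pow, hζ, one_mul, ← hb, Function.iterate_succ_apply]
  refine hasWildSeq_of_one_lt_dist hp hp1 hl (by exact_mod_cast hln) hpl hlam hN hE hbT hyT ?_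
  rwa [show b - ζ * b = (1 - ζ) * b by ring, norm_mul, hN b hbT]

/-- Intermediate binomial coefficients have norm at most `|p|`, so their sizes are at most `λ = 1`.
Hence near a point of norm `R` the map preserves closed unit disks, is isometric at distances below
one, and expands distances above one. -/
theorem binomialSize_prime_le_one {p : ℕ} (hp : p.Prime) (hp1 : ‖(p : L)‖ < 1) {R : ℝ}
    (hR : 1 < R) (hlam : ‖(p : L)‖ * R ^ (p - 1) = 1) {i : ℕ} (hi : i ∈ Finset.Icc 1 p) :
    binomialSize L p R i ≤ 1 := by
  rw [Finset.mem_Icc] at hi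
  rcases hi.2.lt_or_eq with h | rfl
  · rw [← hlam]
    unfold binomialSize
    gcongr ?_ * ?_
    · exact norm_choose_le hp hp1 (Nat.not_dvd_of_pos_of_lt (by omega) h)
    · exact pow_le_pow_right₀ hR.le (by omega)
  · rw [binomialSize_self]

theorem norm_pow_prime_sub_le_one {p : ℕ} (hp : p.Prime) (hp1 : ‖(p : L)‖ < 1) {R : ℝ}
    (hR : 1 < R) (hlam : ‖(p : L)‖ * R ^ (p - 1) = 1) {x y : L} (hx : ‖x‖ = R) (h : ‖y - x‖ ≤ 1) :
    ‖y ^ p - x ^ p‖ ≤ 1 :=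
  norm_pow_sub_pow_le zero_le_one fun i hi => by
    rw [hx]
    exact mul_le_one₀ (binomialSize_prime_le_one hp hp1 hR hlam hi) (by positivity)
      (pow_le_one₀ (norm_nonneg _) h)

theorem norm_pow_prime_sub_eq {p : ℕ} (hp : p.Prime) (hp1 : ‖(p : L)‖ < 1) {R : ℝ}
    (hR : 1 < R) (hlam : ‖(p : L)‖ * R ^ (p - 1) = 1) {x y : L} (hx : ‖x‖ = R) (h : ‖y - x‖ < 1) :
    ‖y ^ p - x ^ p‖ = ‖y - x‖ := by
  by_cases hyx : y = x
  · simp [hyx]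
  have hpos : 0 < ‖y - x‖ := norm_pos_iff.2 (sub_ne_zero.2 hyx)
  have h1 : binomialSize L p ‖x‖ 1 = 1 := by rw [hx, binomialSize_one, hlam]
  rw [norm_pow_sub_pow_eq (j := 1) (Finset.mem_Icc.2 ⟨le_rfl, hp.one_le⟩), h1, one_mul, pow_one]
  intro i hi hi1
  rw [h1, one_mul, hx]
  refine (mul_le_of_le_one_left (by positivity)
    (binomialSize_prime_le_one hp hp1 hR hlam hi)).trans_lt ?_
  exact pow_lt_pow_right_of_lt_one₀ hpos h (by have := (Finset.mem_Icc.1 hi).1; omega)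

theorem norm_sub_le_one_of_norm_pow_prime_sub_le_one {p : ℕ} (hp : p.Prime) (hp1 : ‖(p : L)‖ < 1) {R : ℝ}
    (hR : 1 < R) (hlam : ‖(p : L)‖ * R ^ (p - 1) = 1) {x y : L} (hx : ‖x‖ = R)
    (h : ‖y ^ p - x ^ p‖ ≤ 1) : ‖y - x‖ ≤ 1 := by
  by_contra! hlt
  have hpp : p ∈ Finset.Icc 1 p := Finset.mem_Icc.2 ⟨hp.one_le, le_rfl⟩
  rw [norm_pow_sub_pow_eq (j := p) hpp, binomialSize_self, one_mul] at h
  · exact h.not_gt (one_lt_pow₀ hlt hp.ne_zero)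
  · intro i hi hip
    rw [binomialSize_self, one_mul, hx]
    refine (mul_le_of_le_one_left (by positivity)
      (binomialSize_prime_le_one hp hp1 hR hlam hi)).trans_lt ?_
    exact pow_lt_pow_right₀ hlt (by have := (Finset.mem_Icc.1 hi).2; omega)

theorem norm_fixedPoint {l : ℕ} (hl : 2 ≤ l) {c b : L} {R : ℝ} (hR : 1 < R) (hRc : R ^ l = ‖c‖)
    (hb : b ^ l - c = b) : ‖b‖ = R := by
  have hc : 1 < ‖c‖ := by rw [← hRc]; exact one_lt_pow₀ hR (by omega)
  have hbl : b ^ l = c + b := by linear_combination hb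
  have hlt : ‖b‖ < ‖c‖ := by
    by_contra! hle
    have h1 : ‖b‖ ^ l ≤ ‖b‖ := by
      rw [← norm_pow, hbl]
      exact (IsUltrametricDist.norm_add_le_max _ _).trans (max_le hle le_rfl)
    have h2 : ‖b‖ ^ 1 < ‖b‖ ^ l := pow_lt_pow_right₀ (hc.trans_le hle) (by omega)
    rw [pow_one] at h2
    exact h2.not_ge h1
  refine eq_of_pow_eq_of_nonneg (by omega : l ≠ 0) (norm_nonneg _) (by linarith) ?_
  rw [hRc, ← norm_pow, hbl, norm_add_eq_left hlt]

/-- Test the pair `z, f(z)`. If its distance is at most one, the factorisation of `f(z) - z` over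
the fixed points puts some fixed point `b` within distance one of `z`. The unit disk around `b` is
mapped into itself, so it contains `a`. -/
theorem hasWildSeq_of_boundary_prime [IsAlgClosed L] [CharZero L] {p : ℕ} (hp : p.Prime)
    (hp1 : ‖(p : L)‖ < 1) {c a : L} (hlc : ‖(p : L)‖ ^ p * ‖c‖ ^ (p - 1) = 1)
    (hnear : ¬ ∃ b, b ^ p - c = b ∧ ‖a - b‖ ≤ 1) {E : Subfield L} (hE : tree p c a 0 ⊆ E) :
    HasWildSeq p E := by
  obtain ⟨R, hR, hRc, hlam⟩ := exists_boundary_radius hp.two_le hp1 hlc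
  obtain ⟨N, hN⟩ := norm_eq_of_mem_tree_of_pow_eq hp.two_le (a := a) hR hRc
  obtain ⟨z, hz⟩ := exists_mem_tree hp.ne_zero c a (N + 1)
  have hzT : z ∈ tree p c a N := ⟨N + 1, by omega, hz⟩
  have hfT : z ^ p - c ∈ tree p c a N := ⟨N, le_rfl, by rwa [Function.iterate_succ_apply] at hz⟩
  rcases lt_or_ge 1 ‖(z ^ p - c) - z‖ with h | h
  · exact hasWildSeq_of_one_lt_dist hp hp1 hp.two_le (by exact_mod_cast hp.ne_zero) dvd_rfl hlam hN
      hE hfT hzT h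
  refine absurd ?_ hnear
  obtain ⟨b, hb, hzb⟩ : ∃ b, b ^ p - c = b ∧ ‖z - b‖ ≤ 1 := by
    set g : L[X] := X ^ p - (X + C c) with hg
    have hlt : (X + C c : L[X]).degree < (X ^ p : L[X]).degree := by
      rw [degree_X_add_C, degree_X_pow]; exact_mod_cast hp.one_lt
    have hmon : g.Monic := (monic_X_pow p).sub_of_left hlt
    have hev : g.eval z = (z ^ p - c) - z := by simp [hg]; ring
    have hs := (IsAlgClosed.splits g).eq_prod_roots_of_monic hmon
    by_contra! hcon
    have hprod : g.eval z = (g.roots.map fun x => z - x).prod := by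
      conv_lhs => rw [hs]
      rw [eval_multiset_prod, Multiset.map_map]
      simp
    have hroot : ∀ x ∈ g.roots, 1 < ‖z - x‖ := fun x hx => by
      refine hcon x ?_
      have : x ^ p - (x + c) = 0 := by simpa [hg] using (mem_roots'.1 hx).2
      linear_combination this
    have hne : g.roots ≠ 0 := by
      intro h0
      have := (IsAlgClosed.splits g).natDegree_eq_card_roots
      rw [h0, Multiset.card_zero, hg, natDegree_sub_eq_left_of_natDegree_lt] at this
      · rw [natDegree_X_pow] at this
        exact hp.ne_zero this
      · rw [natDegree_X_add_C, natDegree_X_pow]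
        exact hp.one_lt
    have hgt : ∀ s : Multiset L, s ≠ 0 → (∀ x ∈ s, 1 < ‖z - x‖) →
        1 < ‖(s.map fun x => z - x).prod‖ := by
      intro s
      induction s using Multiset.induction_on with
      | empty => intro h; exact absurd rfl h
      | cons x s ih =>
        intro _ hs
        rw [Multiset.map_cons, Multiset.prod_cons, norm_mul]
        have hx := hs x (Multiset.mem_cons_self _ _)
        by_cases hs0 : s = 0
        · simpa [hs0] using hx
        · exact one_lt_mul_of_lt_of_le hx (ih hs0 fun y hy => hs y (Multiset.mem_cons_of_mem hy)).le
    have := hgt _ hne hroot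
    rw [← hprod, hev] at this
    exact this.not_ge h
  have hbR := norm_fixedPoint hp.two_le hR hRc hb
  have hind : ∀ n, ‖(fun z => z ^ p - c)^[n] z - b‖ ≤ 1 := by
    intro n
    induction n with
    | zero => exact hzb
    | succ n ih =>
      rw [Function.iterate_succ_apply']
      have := norm_pow_prime_sub_le_one hp hp1 hR hlam hbR ih
      rwa [show ((fun z => z ^ p - c)^[n] z) ^ p - b ^ p =
        (((fun z => z ^ p - c)^[n] z) ^ p - c) - b by linear_combination -hb] at this
  refine ⟨b, hb, ?_⟩
  rw [← hz]
  exact hind (N + 1)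

/-- In the good boundary case, all points over `a` lie in the closed unit disk around the fixed
point, and distinct points of one level are at distance one. -/
theorem norm_sub_eq_one_of_near {p : ℕ} (hp : p.Prime) (hp1 : ‖(p : L)‖ < 1) {R : ℝ} (hR : 1 < R)
    (hlam : ‖(p : L)‖ * R ^ (p - 1) = 1) {c a b : L} (hRc : R ^ p = ‖c‖) (hb : b ^ p - c = b)
    (hab : ‖a - b‖ ≤ 1) (n : ℕ) {x y : L} (hx : (fun z => z ^ p - c)^[n] x = a)
    (hy : (fun z => z ^ p - c)^[n] y = a) :
    ‖x - b‖ ≤ 1 ∧ (x ≠ y → ‖x - y‖ = 1) := by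
  have hbR := norm_fixedPoint hp.two_le hR hRc hb
  have hnear : ∀ n z, (fun z => z ^ p - c)^[n] z = a → ‖z - b‖ ≤ 1 := by
    intro n
    induction n with
    | zero => intro z hz; rw [Function.iterate_zero, id] at hz; rwa [hz]
    | succ n ih =>
      intro z hz
      rw [Function.iterate_succ_apply] at hz
      refine norm_sub_le_one_of_norm_pow_prime_sub_le_one hp hp1 hR hlam hbR ?_
      rw [show z ^ p - b ^ p = (z ^ p - c) - b by linear_combination -hb]
      exact ih _ hz
  refine ⟨hnear n x hx, ?_⟩
  induction n generalizing x y with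
  | zero => intro hxy; exact absurd (hx.trans hy.symm) hxy
  | succ n ih =>
    intro hxy
    have h1 : ‖x - y‖ ≤ 1 := by
      rw [show x - y = (x - b) - (y - b) by ring]
      exact (norm_sub_le_max _ _).trans (max_le (hnear _ _ hx) (hnear _ _ hy))
    -- At distance less than one the map is isometric, so the images would be distinct points of the
    -- preceding level at distance less than one.
    refine h1.lt_or_eq.resolve_left fun hlt => ?_
    have hyR : ‖y‖ = R := by
      rw [← hbR, show y = b + (y - b) by ring]
      exact norm_add_eq_left ((hnear _ _ hy).trans_lt (by rwa [hbR]))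
    have hiso := norm_pow_prime_sub_eq hp hp1 hR hlam hyR hlt
    rw [← sub_sub_sub_cancel_right _ _ c] at hiso
    rw [Function.iterate_succ_apply] at hx hy
    have hne : x ^ p - c ≠ y ^ p - c := fun h => by
      rw [h, sub_self, norm_zero] at hiso
      exact hxy (sub_eq_zero.1 (norm_eq_zero.1 hiso.symm))
    rw [ih hx hy hne] at hiso
    exact hlt.ne' hiso

/-- In the boundary case there are arbitrarily large uniformly separated sets of points over `a`. -/
theorem exists_separated_points [IsAlgClosed L] [CharZero L] {l : ℕ} (hl : 2 ≤ l)
    (hl1 : ‖(l : L)‖ < 1) {c : L} (a : L) (hlc : ‖(l : L)‖ ^ l * ‖c‖ ^ (l - 1) = 1) :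
    ∃ δ > 0, ∃ R : ℝ, ∀ n : ℕ, ∃ S : Finset L, S.card = l ^ n ∧ ↑S ⊆ tree l c a 0 ∧
      (∀ x ∈ S, ‖x‖ = R) ∧ ∀ x ∈ S, ∀ y ∈ S, x ≠ y → δ ≤ ‖x - y‖ := by
  classical
  have hln : l ≠ 0 := by omega
  have hl0 : (l : L) ≠ 0 := by exact_mod_cast hln
  obtain ⟨R, hR, hRc, hlam⟩ := exists_boundary_radius hl hl1 hlc
  obtain ⟨N, hN⟩ := norm_eq_of_mem_tree_of_pow_eq hl (a := a) hR hRc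
  obtain ⟨δ, hδ, hiso⟩ := exists_norm_pow_sub_pow_eq_mul hln hl0 hR.le
  obtain ⟨w, hw⟩ := exists_mem_tree hln c a N
  have hwT : w ∈ tree l c a N := ⟨N, le_rfl, hw⟩
  have hT : ∀ n x, (fun z => z ^ l - c)^[n] x = w → x ∈ tree l c a N := fun n x hx =>
    mem_tree_of_iterate_mem n (by rw [hx]; exact hwT)
  refine ⟨δ, hδ, R, fun n => ?_⟩
  set g := iteratePoly l c n - C w with hg
  have hdeg : g.natDegree = l ^ n := by rw [hg, natDegree_sub_C, natDegree_iteratePoly]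
  have hg0 : g ≠ 0 := by
    rintro h
    rw [h, natDegree_zero] at hdeg
    exact (pow_ne_zero n hln) hdeg.symm
  have hroot : ∀ x, x ∈ g.roots.toFinset ↔ (fun z => z ^ l - c)^[n] x = w := fun x => by
    rw [Multiset.mem_toFinset, mem_roots hg0, IsRoot.def, hg, eval_sub, eval_C, eval_iteratePoly,
      sub_eq_zero]
  -- All roots are simple, so level `n` over `w` has exactly `l ^ n` points.
  have hder : ∀ n x, (fun z => z ^ l - c)^[n] x = w →
      (iteratePoly l c n).derivative.eval x ≠ 0 := by
    intro n
    induction n with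
    | zero => intro x _; simp [iteratePoly]
    | succ n ih =>
      intro x hx
      have hx0 : x ≠ 0 := by
        rintro rfl
        have := hN 0 (hT _ _ hx)
        rw [norm_zero] at this
        linarith
      rw [Function.iterate_succ_apply] at hx
      rw [eval_derivative_iteratePoly_succ]
      exact mul_ne_zero (mul_ne_zero hl0 (pow_ne_zero _ hx0)) (ih _ hx)
  have hnodup : g.roots.Nodup := by
    rw [Multiset.nodup_iff_count_le_one]
    intro x
    rw [count_roots]
    by_contra! hlt
    have := (one_lt_rootMultiplicity_iff_isRoot hg0).1 hlt
    refine hder n x ((hroot x).1 (by simpa [hg0] using this.1)) ?_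
    simpa [hg] using this.2
  refine ⟨g.roots.toFinset, ?_, ?_, ?_, ?_⟩
  · rw [Multiset.toFinset_card_of_nodup hnodup,
      ← (IsAlgClosed.splits g).natDegree_eq_card_roots, hdeg]
  · intro x hx
    exact tree_subset (Nat.zero_le N) (hT n x ((hroot x).1 hx))
  · intro x hx
    exact hN x (hT n x ((hroot x).1 hx))
  · intro x hx y hy
    rw [hroot] at hx hy
    clear hroot hnodup hg0 hdeg
    induction n generalizing x y with
    | zero => intro hxy; exact absurd (hx.trans hy.symm) hxy
    | succ n ih =>
      intro hxy
      -- Below `δ` the map scales by `λ = 1`, so a close pair would descend to a close pair of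
      -- distinct points one level lower.
      by_contra! hlt
      have h1 := hiso y x (hN y (hT _ _ hy)) hlt
      rw [hlam, one_mul, ← sub_sub_sub_cancel_right _ _ c] at h1
      rw [Function.iterate_succ_apply] at hx hy
      have hne : x ^ l - c ≠ y ^ l - c := fun h => by
        rw [h, sub_self, norm_zero] at h1
        exact hxy (sub_eq_zero.1 (norm_eq_zero.1 h1.symm))
      have := ih rfl _ hx _ hy hne
      rw [h1] at this
      exact hlt.not_ge this

end Boundary

/-! ### Value groups and ramification indices. -/

section Spectral

variable {K : Type*} [NontriviallyNormedField K] [IsUltrametricDist K] [CompleteSpace K]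

/-- The algebraic closure, normed by the spectral norm. -/
@[reducible]
noncomputable def normedFieldAlgebraicClosure : NormedField (AlgebraicClosure K) :=
  spectralNorm.normedField K (AlgebraicClosure K)

attribute [local instance] normedFieldAlgebraicClosure

theorem norm_eq_spectralNorm (x : AlgebraicClosure K) :
    ‖x‖ = spectralNorm K (AlgebraicClosure K) x := rfl

theorem isUltrametricDist_algebraicClosure : IsUltrametricDist (AlgebraicClosure K) :=
  IsUltrametricDist.isUltrametricDist_of_isNonarchimedean_norm isNonarchimedean_spectralNorm

attribute [local instance] isUltrametricDist_algebraicClosure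

theorem norm_algebraMap_algebraicClosure (x : K) :
    ‖algebraMap K (AlgebraicClosure K) x‖ = ‖x‖ := spectralNorm_extends x

theorem norm_algEquiv (σ : AlgebraicClosure K ≃ₐ[K] AlgebraicClosure K) (x : AlgebraicClosure K) :
    ‖σ x‖ = ‖x‖ := (spectralNorm_eq_of_equiv σ x).symm

theorem mem_valueGroup_iff {E : IntermediateField K (AlgebraicClosure K)} {u : ℝˣ} :
    u ∈ valueGroup E ↔ ∃ x ∈ E, x ≠ 0 ∧ (u : ℝ) = ‖x‖ := by
  constructor
  · rintro ⟨y, rfl⟩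
    exact ⟨((y : E) : AlgebraicClosure K), (y : E).2, by simp, rfl⟩
  · rintro ⟨x, hx, hx0, hu⟩
    refine ⟨Units.mk0 ⟨x, hx⟩ (by simpa [Subtype.ext_iff] using hx0), Units.ext hu.symm⟩

theorem pos_of_mem_valueGroup {E : IntermediateField K (AlgebraicClosure K)} {u : ℝˣ}
    (hu : u ∈ valueGroup E) : 0 < (u : ℝ) := by
  obtain ⟨x, -, hx0, hu⟩ := mem_valueGroup_iff.1 hu
  rw [hu]
  exact norm_pos_iff.2 hx0

theorem valueGroup_mono {E F : IntermediateField K (AlgebraicClosure K)} (h : E ≤ F) :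
    valueGroup E ≤ valueGroup F := fun u hu => by
  obtain ⟨x, hx, hx0, hu⟩ := mem_valueGroup_iff.1 hu
  exact mem_valueGroup_iff.2 ⟨x, h hx, hx0, hu⟩

/-- The value group of `K` is generated by the absolute value of a uniformizer. -/
theorem exists_valueGroup_bot_eq_zpowers [IsDiscreteValuationRing (RingOfIntegers K)] :
    ∃ π : ℝˣ, 0 < (π : ℝ) ∧ (π : ℝ) < 1 ∧
      valueGroup (⊥ : IntermediateField K (AlgebraicClosure K)) = Subgroup.zpowers π := by
  obtain ⟨ϖ, hϖ⟩ := IsDiscreteValuationRing.exists_irreducible (RingOfIntegers K)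
  have hϖ0 : (ϖ : K) ≠ 0 := by simpa using hϖ.ne_zero
  have hunit : ∀ u : (RingOfIntegers K)ˣ, ‖((u : RingOfIntegers K) : K)‖ = 1 := by
    intro u
    have h1 : ‖((u : RingOfIntegers K) : K)‖ ≤ 1 := (u : RingOfIntegers K).2
    have h2 : ‖(((u⁻¹ : (RingOfIntegers K)ˣ) : RingOfIntegers K) : K)‖ ≤ 1 :=
      ((u⁻¹ : (RingOfIntegers K)ˣ) : RingOfIntegers K).2
    have h3 : ((u : RingOfIntegers K) : K) * ((u⁻¹ : (RingOfIntegers K)ˣ) : RingOfIntegers K) = 1 := by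
      rw [← MulMemClass.coe_mul, Units.mul_inv]; rfl
    have h4 := congrArg norm h3
    rw [norm_mul, norm_one] at h4
    refine le_antisymm h1 ?_
    rw [← h4]
    exact mul_le_of_le_one_right (norm_nonneg _) h2
  have hϖ1 : ‖(ϖ : K)‖ < 1 := by
    refine lt_of_le_of_ne ϖ.2 fun h => hϖ.not_isUnit ?_
    have hinv : ‖(ϖ : K)⁻¹‖ ≤ 1 := by rw [norm_inv, show ‖(ϖ : K)‖ = 1 from h, inv_one]
    refine IsUnit.of_mul_eq_one (⟨(ϖ : K)⁻¹, hinv⟩ : RingOfIntegers K) ?_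
    exact Subtype.ext (mul_inv_cancel₀ hϖ0)
  have hϖn : ‖(ϖ : K)‖ ≠ 0 := norm_ne_zero_iff.2 hϖ0
  have hint : ∀ x : K, x ≠ 0 → ‖x‖ ≤ 1 → ∃ n : ℕ, ‖x‖ = ‖(ϖ : K)‖ ^ n := by
    intro x hx0 hx1
    obtain ⟨n, u, h⟩ := IsDiscreteValuationRing.eq_unit_mul_pow_irreducible
      (x := (⟨x, hx1⟩ : RingOfIntegers K)) (by simpa [Subtype.ext_iff] using hx0) hϖ
    have h' : x = (u : RingOfIntegers K) * (ϖ : K) ^ n := congrArg Subtype.val h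
    exact ⟨n, by rw [h', norm_mul, hunit, one_mul, norm_pow]⟩
  have hall : ∀ x : K, x ≠ 0 → ∃ n : ℤ, ‖x‖ = ‖(ϖ : K)‖ ^ n := by
    intro x hx0
    rcases le_total ‖x‖ 1 with h | h
    · obtain ⟨n, hn⟩ := hint x hx0 h
      exact ⟨n, by rw [hn, zpow_natCast]⟩
    · obtain ⟨n, hn⟩ := hint x⁻¹ (inv_ne_zero hx0) (by rw [norm_inv]; exact inv_le_one_of_one_le₀ h)
      exact ⟨-n, by rw [zpow_neg, zpow_natCast, ← hn, norm_inv, inv_inv]⟩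
  refine ⟨Units.mk0 ‖(ϖ : K)‖ hϖn, norm_pos_iff.2 hϖ0, hϖ1, ?_⟩
  ext u
  rw [mem_valueGroup_iff, Subgroup.mem_zpowers_iff]
  constructor
  · rintro ⟨x, hx, hx0, hu⟩
    obtain ⟨y, rfl⟩ := IntermediateField.mem_bot.1 hx
    obtain ⟨n, hn⟩ := hall y (by rintro rfl; simp at hx0)
    refine ⟨n, Units.ext ?_⟩
    rw [hu, norm_algebraMap_algebraicClosure, hn, Units.val_zpow_eq_zpow_val, Units.val_mk0]
  · rintro ⟨n, rfl⟩
    refine ⟨algebraMap K _ ((ϖ : K) ^ n), IntermediateField.mem_bot.2 ⟨_, rfl⟩, ?_, ?_⟩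
    · simp [zpow_ne_zero, hϖ0]
    · rw [norm_algebraMap_algebraicClosure, norm_zpow, Units.val_zpow_eq_zpow_val, Units.val_mk0]

/-- The spectral norm satisfies `|x|^deg = |constant coefficient of the minimal polynomial|`. -/
theorem pow_natDegree_minpoly_mem {E : IntermediateField K (AlgebraicClosure K)}
    {x : AlgebraicClosure K} {u : ℝˣ} (hx0 : x ≠ 0) (hu : (u : ℝ) = ‖x‖) :
    u ^ (minpoly K x).natDegree ∈ valueGroup E := by
  have hint : IsIntegral K x := Algebra.IsIntegral.isIntegral x
  refine valueGroup_mono bot_le (mem_valueGroup_iff.2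
    ⟨algebraMap K _ ((minpoly K x).coeff 0), IntermediateField.mem_bot.2 ⟨_, rfl⟩, ?_, ?_⟩)
  · rw [Ne, FaithfulSMul.algebraMap_eq_zero_iff]
    exact minpoly.coeff_zero_ne_zero hint hx0
  · rw [norm_algebraMap_algebraicClosure, Units.val_pow_eq_pow_val, hu, norm_eq_spectralNorm,
      spectralNorm.spectralNorm_eq_norm_coeff_zero_rpow, one_div, Real.rpow_inv_natCast_pow
      (norm_nonneg _) (minpoly.natDegree_pos hint).ne']

theorem pow_finrank_mem {F : IntermediateField K (AlgebraicClosure K)} [FiniteDimensional K F]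
    {u : ℝˣ} (hu : u ∈ valueGroup F) :
    u ^ Module.finrank K F ∈ valueGroup (⊥ : IntermediateField K (AlgebraicClosure K)) := by
  obtain ⟨x, hx, hx0, hu⟩ := mem_valueGroup_iff.1 hu
  have hdvd : (minpoly K x).natDegree ∣ Module.finrank K F := by
    have := minpoly.degree_dvd (K := K) (L := F) (x := ⟨x, hx⟩) (Algebra.IsIntegral.isIntegral _)
    rwa [IntermediateField.minpoly_eq] at this
  obtain ⟨k, hk⟩ := hdvd
  rw [hk, pow_mul]
  exact Subgroup.pow_mem _ (pow_natDegree_minpoly_mem hx0 hu) k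

/-- With `N = [F : K]`, each value `u` of `F` satisfies `u^N = π^k`, and `k` modulo `N` determines
its class, so the index is finite and not the default value `0`. -/
theorem ramificationIndex_ne_zero [IsDiscreteValuationRing (RingOfIntegers K)]
    (F : IntermediateField K (AlgebraicClosure K)) [FiniteDimensional K F] :
    ramificationIndex F ≠ 0 := by
  obtain ⟨π, hπ0, hπ1, hbot⟩ := exists_valueGroup_bot_eq_zpowers (K := K)
  set N := Module.finrank K F with hN
  have hN0 : N ≠ 0 := Module.finrank_pos.ne'
  have hmem : ∀ u : valueGroup F, ∃ k : ℤ, π ^ k = (u : ℝˣ) ^ N := fun u => by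
    have := pow_finrank_mem u.2
    rwa [hbot, Subgroup.mem_zpowers_iff] at this
  choose k hk using hmem
  have hinj : Function.Injective fun k : ℤ => π ^ k := by
    intro i j hij
    have := congrArg Units.val hij
    simp only [Units.val_zpow_eq_zpow_val] at this
    exact (zpow_right_inj₀ hπ0 hπ1.ne).1 this
  have hfin : Finite (valueGroup F ⧸
      (valueGroup (⊥ : IntermediateField K (AlgebraicClosure K))).subgroupOf (valueGroup F)) := by
    have : NeZero N := ⟨hN0⟩
    refine Finite.of_injective (β := ZMod N) (fun q => (k q.out : ZMod N)) fun q q' h => ?_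
    rw [← q.out_eq', ← q'.out_eq', QuotientGroup.eq, Subgroup.mem_subgroupOf]
    rw [ZMod.intCast_eq_intCast_iff_dvd_sub] at h
    obtain ⟨m, hm⟩ := h
    have hpow : ((q.out : ℝˣ)⁻¹ * (q'.out : ℝˣ)) ^ N = (π ^ m) ^ N := by
      rw [mul_pow, inv_pow, ← hk, ← hk, ← zpow_neg, ← zpow_add, ← zpow_natCast (π ^ m), ← zpow_mul]
      congr 1
      linarith
    have h1 : (q.out : ℝˣ)⁻¹ * (q'.out : ℝˣ) = π ^ m := by
      have hpos : 0 < (((q.out : ℝˣ)⁻¹ * (q'.out : ℝˣ) : ℝˣ) : ℝ) :=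
        pos_of_mem_valueGroup (mul_mem (inv_mem q.out.2) q'.out.2)
      refine Units.ext (eq_of_pow_eq_of_nonneg hN0 hpos.le ?_ ?_)
      · rw [Units.val_zpow_eq_zpow_val]; positivity
      · rw [← Units.val_pow_eq_pow_val, hpow, Units.val_pow_eq_pow_val]
    change (q.out : ℝˣ)⁻¹ * (q'.out : ℝˣ) ∈ _
    rw [h1, hbot]
    exact Subgroup.zpow_mem_zpowers π m
  exact Subgroup.index_ne_zero_of_finite

theorem isFinitelyRamified_of_valueGroup_le [IsDiscreteValuationRing (RingOfIntegers K)]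
    {E M : IntermediateField K (AlgebraicClosure K)} [FiniteDimensional K M]
    (h : valueGroup E ≤ valueGroup M) : IsFinitelyRamified E :=
  ⟨ramificationIndex M, fun _ hF _ => Subgroup.relIndex_le_of_le_right
    ((valueGroup_mono hF).trans h) (ramificationIndex_ne_zero M)⟩

theorem IsInfinitelyWildlyRamified.not_isFinitelyRamified
    [IsDiscreteValuationRing (RingOfIntegers K)] {p : ℕ} (hp : p.Prime)
    {E : IntermediateField K (AlgebraicClosure K)} (h : IsInfinitelyWildlyRamified p E) :
    ¬ IsFinitelyRamified E := by
  rintro ⟨B, hB⟩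
  obtain ⟨F, hFE, hF, hdvd⟩ := h B
  have h1 := Nat.le_of_dvd (Nat.pos_of_ne_zero (ramificationIndex_ne_zero F)) hdvd
  exact (Nat.lt_pow_self hp.one_lt).not_ge (h1.trans (hB F hFE hF))

/-- Sequences of elements whose sizes are successive `p`-divisible roots force wild ramification. -/
theorem HasWildSeq.isInfinitelyWildlyRamified [IsDiscreteValuationRing (RingOfIntegers K)] {p : ℕ}
    (hp : p.Prime) {E : IntermediateField K (AlgebraicClosure K)}
    (h : HasWildSeq p E.toSubfield) : IsInfinitelyWildlyRamified p E := by
  obtain ⟨x, d, hxE, hx0, hx1, hrec⟩ := h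
  obtain ⟨π, hπ0, hπ1, hbot⟩ := exists_valueGroup_bot_eq_zpowers (K := K)
  have hinj : ∀ i j : ℤ, π ^ i = π ^ j → i = j := by
    intro i j hij
    have := congrArg Units.val hij
    simp only [Units.val_zpow_eq_zpow_val] at this
    exact (zpow_right_inj₀ hπ0 hπ1.ne).1 this
  have hdpos : ∀ n, ∃ D : ℕ, p ^ n ∣ D ∧ ‖x 0‖ = ‖x n‖ ^ D := by
    intro n
    induction n with
    | zero => exact ⟨1, by simp⟩
    | succ n ih =>
      obtain ⟨D, hD, hDx⟩ := ih
      refine ⟨d n * D, ?_, ?_⟩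
      · rw [pow_succ']; exact mul_dvd_mul (hrec n).1 hD
      · rw [hDx, (hrec n).2, pow_mul]
  have hxn : ∀ n, x n ≠ 0 := fun n hn => by
    obtain ⟨D, -, hD⟩ := hdpos n
    rw [hn, norm_zero] at hD
    rcases Nat.eq_zero_or_pos D with h | h
    · rw [h, pow_zero] at hD; exact hx1 hD
    · rw [zero_pow h.ne'] at hD; exact hx0 (norm_eq_zero.1 hD)
  let u : ℕ → ℝˣ := fun n => Units.mk0 ‖x n‖ (norm_ne_zero_iff.2 (hxn n))
  have hdeg : (minpoly K (x 0)).natDegree ≠ 0 :=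
    (minpoly.natDegree_pos (Algebra.IsIntegral.isIntegral _)).ne'
  set N := (minpoly K (x 0)).natDegree
  obtain ⟨b, hb⟩ : ∃ b : ℤ, π ^ b = u 0 ^ N := by
    have := pow_natDegree_minpoly_mem (E := ⊥) (u := u 0) hx0 rfl
    rwa [hbot, Subgroup.mem_zpowers_iff] at this
  have hb0 : b ≠ 0 := by
    rintro rfl
    rw [zpow_zero] at hb
    have h1 := congrArg Units.val hb.symm
    rw [Units.val_pow_eq_pow_val, Units.val_one] at h1
    exact hx1 ((pow_eq_one_iff_of_nonneg (norm_nonneg _) hdeg).1 h1)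
  intro m
  -- The exponent `b` of `|x 0|^N` may absorb `t` factors of `p`; going `t` steps further
  -- compensates.
  set t := (multiplicity (p : ℤ) b) with ht
  set n := m + t with hn
  have hint : IsIntegral K (x n) := Algebra.IsIntegral.isIntegral _
  refine ⟨IntermediateField.adjoin K {x n}, ?_, IntermediateField.adjoin.finiteDimensional hint, ?_⟩
  · rw [IntermediateField.adjoin_le_iff, Set.singleton_subset_iff]
    exact hxE n
  set F := IntermediateField.adjoin K {x n}
  set e := ramificationIndex F with he
  have huF : u n ∈ valueGroup F :=
    mem_valueGroup_iff.2 ⟨x n, IntermediateField.mem_adjoin_simple_self K _, hxn n, rfl⟩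
  obtain ⟨w, hw⟩ : ∃ w : ℤ, π ^ w = u n ^ e := by
    have h1 := Subgroup.pow_index_mem ((valueGroup
      (⊥ : IntermediateField K (AlgebraicClosure K))).subgroupOf (valueGroup F)) ⟨u n, huF⟩
    rw [Subgroup.mem_subgroupOf, hbot, Subgroup.mem_zpowers_iff] at h1
    obtain ⟨w, hw⟩ := h1
    refine ⟨w, hw.trans ?_⟩
    rw [he, ramificationIndex, hbot]
    rfl
  obtain ⟨D, hD, hDx⟩ := hdpos n
  have hu0 : u 0 = u n ^ D := Units.ext (by simpa [u] using hDx)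
  -- Compare exponents of `π` in `|x 0|^(N e) = |x n|^(D N e)`.
  have hkey : b * e = w * (D * N) := by
    refine hinj _ _ ?_
    rw [zpow_mul, hb, zpow_mul, hw, hu0]
    norm_cast
    rw [← pow_mul, ← pow_mul, ← pow_mul]
    congr 1
    ring
  have hdvd : (p : ℤ) ^ n ∣ b * e := by
    rw [hkey]
    exact Dvd.dvd.mul_left (Dvd.dvd.mul_right (by exact_mod_cast hD) _) _
  have hpI : Prime (p : ℤ) := Nat.prime_iff_prime_int.1 hp
  have hfin : FiniteMultiplicity (p : ℤ) b :=
    Int.finiteMultiplicity_iff.2 ⟨by simpa using hp.ne_one, hb0⟩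
  obtain ⟨b', hb', hpb'⟩ := hfin.exists_eq_pow_mul_and_not_dvd
  rw [hb', ← ht, hn, pow_add, mul_comm ((p : ℤ) ^ m), mul_assoc] at hdvd
  have h2 : (p : ℤ) ^ m ∣ b' * e :=
    (mul_dvd_mul_iff_left (pow_ne_zero _ hpI.ne_zero)).1 hdvd
  have h3 := hpI.pow_dvd_of_dvd_mul_left m hpb' h2
  exact_mod_cast h3

end Spectral

/-! ### Coefficient bounds by Lagrange interpolation. -/

section LagrangeBound

variable {L : Type*} [NormedField L] [IsUltrametricDist L]

theorem norm_coeff_mul_le_one {f g : L[X]} (hf : ∀ i, ‖f.coeff i‖ ≤ 1) (hg : ∀ i, ‖g.coeff i‖ ≤ 1)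
    (i : ℕ) : ‖(f * g).coeff i‖ ≤ 1 := by
  rw [coeff_mul]
  refine IsUltrametricDist.norm_sum_le_of_forall_le_of_nonneg zero_le_one fun j _ => ?_
  rw [norm_mul]
  exact mul_le_one₀ (hf _) (norm_nonneg _) (hg _)

theorem norm_coeff_prod_le_one {ι : Type*} (s : Finset ι) (f : ι → L[X])
    (hf : ∀ j ∈ s, ∀ i, ‖(f j).coeff i‖ ≤ 1) (i : ℕ) : ‖(∏ j ∈ s, f j).coeff i‖ ≤ 1 := by
  classical
  induction s using Finset.induction_on generalizing i with
  | empty => rw [Finset.prod_empty, coeff_one]; split_ifs <;> simp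
  | insert a s ha ih =>
    rw [Finset.prod_insert ha]
    exact norm_coeff_mul_le_one (hf a (Finset.mem_insert_self _ _))
      (ih fun j hj => hf j (Finset.mem_insert_of_mem hj)) i

/-- A polynomial bounded on sufficiently many integral points with pairwise distance one has
coefficients with the same bound. -/
theorem norm_coeff_le_of_separated_nodes {s : Finset L} (hs1 : ∀ x ∈ s, ‖x‖ ≤ 1)
    (hs : ∀ x ∈ s, ∀ y ∈ s, x ≠ y → ‖x - y‖ = 1) {g : L[X]} (hg : g.degree < s.card) {B : ℝ}
    (hB0 : 0 ≤ B) (hB : ∀ x ∈ s, ‖g.eval x‖ ≤ B) (i : ℕ) : ‖g.coeff i‖ ≤ B := by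
  classical
  rw [Lagrange.eq_interpolate (v := id) (s := s) Function.injective_id.injOn hg,
    Lagrange.interpolate_apply, finsetSum_coeff]
  refine IsUltrametricDist.norm_sum_le_of_forall_le_of_nonneg hB0 fun x hx => ?_
  rw [coeff_C_mul, norm_mul]
  refine (mul_le_of_le_one_right (norm_nonneg _) ?_).trans (hB x hx)
  -- The denominators of the Lagrange basis are units, so its coefficients are integral.
  refine norm_coeff_prod_le_one _ _ (fun y hy i => ?_) i
  rw [Finset.mem_erase] at hy
  have hxy := hs x hx y hy.2 (Ne.symm hy.1)
  rw [Lagrange.basisDivisor, id, id, coeff_C_mul, norm_mul, norm_inv, hxy, inv_one, one_mul,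
    coeff_sub]
  refine (norm_sub_le_max _ _).trans (max_le ?_ ?_)
  · rw [coeff_X]; split_ifs <;> simp
  · rw [coeff_C]; split_ifs
    · exact hs1 y hy.2
    · simp

end LagrangeBound

/-! ### Finite ramification near a fixed point, and finiteness in the expanding case. -/

section Spectral

variable {K : Type*} [NontriviallyNormedField K]

theorem eval_unicritical (l : ℕ) (c : AlgebraicClosure K) :
    (fun z => (unicritical l c).eval z) = fun z => z ^ l - c := by
  funext z; simp [unicritical]

theorem levelInfty_eq_adjoin (f : (AlgebraicClosure K)[X]) (a : K) :
    levelInfty f a = IntermediateField.adjoin K (⋃ n, preimages f a n) := by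
  refine le_antisymm (iSup_le fun n => IntermediateField.adjoin.mono K _ _
    (Set.subset_iUnion _ n)) ?_
  rw [IntermediateField.adjoin_le_iff, Set.iUnion_subset_iff]
  exact fun n => (IntermediateField.subset_adjoin K _).trans
    (SetLike.coe_subset_coe.2 (le_iSup (level f a) n))

theorem algEquiv_iterate {F : Type*} [Field F] [Algebra F (AlgebraicClosure K)] {l : ℕ}
    {c : AlgebraicClosure K} (σ : AlgebraicClosure K ≃ₐ[F] AlgebraicClosure K) (hc : σ c = c)
    (n : ℕ) (z : AlgebraicClosure K) :
    (fun z => z ^ l - c)^[n] (σ z) = σ ((fun z => z ^ l - c)^[n] z) := by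
  induction n generalizing z with
  | zero => rfl
  | succ n ih =>
    rw [Function.iterate_succ_apply, Function.iterate_succ_apply, ← ih]
    simp [hc]

theorem mem_preimages_unicritical {l : ℕ} {c : AlgebraicClosure K} {a : K} {n : ℕ}
    {z : AlgebraicClosure K} : z ∈ preimages (unicritical l c) a n ↔
      (fun z => z ^ l - c)^[n] z = algebraMap K _ a := by
  rw [preimages, Set.mem_ofPred_eq, eval_unicritical]

variable [IsUltrametricDist K] [CompleteSpace K]

attribute [local instance] normedFieldAlgebraicClosure isUltrametricDist_algebraicClosure

/-- Adjoining an integral element whose conjugates have pairwise distance one does not change the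
value group. -/
theorem exists_norm_eq_of_mem_adjoin_simple [CharZero K]
    (M : IntermediateField K (AlgebraicClosure K)) {h : AlgebraicClosure K} (h1 : ‖h‖ ≤ 1)
    (hconj : ∀ σ τ : AlgebraicClosure K ≃ₐ[M] AlgebraicClosure K, σ h ≠ τ h → ‖σ h - τ h‖ = 1)
    {x : AlgebraicClosure K} (hx : x ∈ IntermediateField.adjoin M {h}) :
    ∃ m ∈ M, ‖x‖ = ‖m‖ := by
  classical
  have hσ : ∀ (σ : AlgebraicClosure K ≃ₐ[M] AlgebraicClosure K) y, ‖σ y‖ = ‖y‖ := fun σ y =>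
    norm_algEquiv (σ.restrictScalars K) y
  have hint : IsIntegral M h := Algebra.IsIntegral.isIntegral h
  have hmon := minpoly.monic hint
  obtain ⟨g, hgdeg, hgx⟩ : ∃ g : M[X], g.degree < (minpoly M h).degree ∧ aeval h g = x := by
    have hx' : x ∈ (IntermediateField.adjoin M {h}).toSubalgebra := hx
    rw [IntermediateField.adjoin_simple_toSubalgebra_of_isAlgebraic hint.isAlgebraic,
      Algebra.adjoin_singleton_eq_range_aeval] at hx'
    obtain ⟨g, hg⟩ := hx'
    refine ⟨g %ₘ minpoly M h, degree_modByMonic_lt _ hmon, ?_⟩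
    rw [← hg, aeval_modByMonic_eq_self_of_root (minpoly.aeval M h)]
    rfl
  set P := (minpoly M h).map (algebraMap M (AlgebraicClosure K)) with hP
  set s := P.roots.toFinset with hs
  have hP0 : P ≠ 0 := (hmon.map _).ne_zero
  have hmem : ∀ y ∈ s, ∃ σ : AlgebraicClosure K ≃ₐ[M] AlgebraicClosure K, σ h = y := by
    intro y hy
    rw [hs, Multiset.mem_toFinset, mem_roots hP0, IsRoot.def, hP, eval_map_algebraMap] at hy
    exact minpoly.exists_algEquiv_of_root' hint.isAlgebraic hy
  have hcard : s.card = P.natDegree := by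
    have hsep : P.Separable := (minpoly.irreducible hint).separable.map
    rw [hs, Multiset.toFinset_card_of_nodup (nodup_roots hsep),
      ← (IsAlgClosed.splits P).natDegree_eq_card_roots]
  set G := g.map (algebraMap M (AlgebraicClosure K)) with hG
  have hGdeg : G.degree < s.card := by
    rw [hcard, ← degree_eq_natDegree hP0, hG, hP, degree_map, degree_map]
    exact hgdeg
  -- At the conjugates of `h` the polynomial takes the conjugates of `x`, all of norm `|x|`.
  -- Conversely `x = g(h)` with `|h| ≤ 1` forces some coefficient to reach `|x|`.
  have hco : ∀ i, ‖G.coeff i‖ ≤ ‖x‖ := by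
    refine norm_coeff_le_of_separated_nodes (s := s) ?_ ?_ hGdeg (norm_nonneg _) ?_
    · intro y hy
      obtain ⟨σ, rfl⟩ := hmem y hy
      rw [hσ]; exact h1
    · intro y hy z hz hyz
      obtain ⟨σ, rfl⟩ := hmem y hy
      obtain ⟨τ, rfl⟩ := hmem z hz
      exact hconj σ τ hyz
    · intro y hy
      obtain ⟨σ, rfl⟩ := hmem y hy
      rw [hG, eval_map_algebraMap, ← hσ σ x, ← hgx, ← aeval_algHom_apply]
  have hxG : x = ∑ i ∈ Finset.range (G.natDegree + 1), G.coeff i * h ^ i := by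
    rw [← eval_eq_sum_range, hG, eval_map_algebraMap, hgx]
  obtain ⟨i, -, hi⟩ := IsUltrametricDist.exists_norm_finsetSum_le
    (Finset.range (G.natDegree + 1)) (fun i => G.coeff i * h ^ i)
  rw [← hxG, norm_mul, norm_pow] at hi
  refine ⟨g.coeff i, (g.coeff i).2, le_antisymm (hi.trans ?_) ?_⟩
  · rw [hG, coeff_map]
    exact mul_le_of_le_one_right (norm_nonneg _) (pow_le_one₀ (norm_nonneg _) h1)
  · have := hco i
    rwa [hG, coeff_map] at this

theorem tree_subset_levelInfty (l : ℕ) (c : AlgebraicClosure K) (a : K) :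
    tree l c (algebraMap K (AlgebraicClosure K) a) 0 ⊆
      (levelInfty (unicritical l c) a).toSubfield := by
  rintro z ⟨n, -, hz⟩
  change z ∈ levelInfty (unicritical l c) a
  rw [levelInfty_eq_adjoin]
  exact IntermediateField.subset_adjoin K _
    (Set.mem_iUnion.2 ⟨n, mem_preimages_unicritical.2 hz⟩)

/-- Adjoin tree points to `K(b)` one at a time. Over each intermediate field the conjugates of a
point stay on its level, so they are at mutual distance one and the value group does not change. -/
theorem valueGroup_levelInfty_le_of_near [CharZero K] {p : ℕ} (hp : p.Prime)
    (hp1 : ‖(p : AlgebraicClosure K)‖ < 1) {c b : AlgebraicClosure K} {a : K}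
    (hlc : ‖(p : AlgebraicClosure K)‖ ^ p * ‖c‖ ^ (p - 1) = 1) (hb : b ^ p - c = b)
    (hab : ‖algebraMap K (AlgebraicClosure K) a - b‖ ≤ 1) :
    valueGroup (levelInfty (unicritical p c) a) ≤ valueGroup (IntermediateField.adjoin K {b}) := by
  classical
  obtain ⟨R, hR, hRc, hlam⟩ := exists_boundary_radius hp.two_le hp1 hlc
  have key : ∀ T : Finset (AlgebraicClosure K), (T : Set _) ⊆ (⋃ n, preimages (unicritical p c) a n) →
      ∀ x ∈ IntermediateField.adjoin K (insert b (T : Set (AlgebraicClosure K))),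
        ∃ m ∈ IntermediateField.adjoin K {b}, ‖x‖ = ‖m‖ := by
    intro T
    induction T using Finset.induction_on with
    | empty =>
      intro _ x hx
      refine ⟨x, ?_, rfl⟩
      simpa using hx
    | insert z T hz ih =>
      intro hT x hx
      rw [Finset.coe_insert, Set.insert_subset_iff] at hT
      obtain ⟨n, hn⟩ := Set.mem_iUnion.1 hT.1
      rw [mem_preimages_unicritical] at hn
      set M := IntermediateField.adjoin K (insert b (T : Set (AlgebraicClosure K))) with hM
      have hbM : b ∈ M := IntermediateField.subset_adjoin K _ (Set.mem_insert _ _)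
      -- Needed so that automorphisms over `M` commute with `f`; `c` need not lie in `K`.
      have hcM : c ∈ M := by
        rw [show c = b ^ p - b by linear_combination -hb]
        exact M.sub_mem (pow_mem hbM p) hbM
      have hxM : x ∈ IntermediateField.adjoin M {z - b} := by
        have hle : IntermediateField.adjoin K (insert b ((insert z T : Finset _) : Set _)) ≤
            (IntermediateField.adjoin M {z - b}).restrictScalars K := by
          rw [IntermediateField.adjoin_le_iff, Finset.coe_insert, Set.insert_comm]
          have hMle : ∀ y ∈ M, y ∈ IntermediateField.adjoin M {z - b} := fun y hy =>
            (IntermediateField.adjoin M {z - b}).algebraMap_mem ⟨y, hy⟩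
          rintro y (rfl | hy)
          · have h1 := IntermediateField.mem_adjoin_simple_self M (y - b)
            have h2 := (IntermediateField.adjoin M {y - b}).add_mem h1 (hMle b hbM)
            rwa [sub_add_cancel] at h2
          · exact hMle y (IntermediateField.subset_adjoin K _ hy)
        exact hle hx
      have hfix : ∀ σ : AlgebraicClosure K ≃ₐ[M] AlgebraicClosure K, ∀ y ∈ M, σ y = y :=
        fun σ y hy => σ.commutes ⟨y, hy⟩
      have hlev : ∀ σ : AlgebraicClosure K ≃ₐ[M] AlgebraicClosure K,
          (fun z => z ^ p - c)^[n] (σ z) = algebraMap K _ a := fun σ => by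
        rw [algEquiv_iterate σ (hfix σ c hcM), hn]
        exact hfix σ _ (M.algebraMap_mem a)
      obtain ⟨m, hm, hxm⟩ := exists_norm_eq_of_mem_adjoin_simple M (h := z - b)
        (norm_sub_eq_one_of_near hp hp1 hR hlam hRc hb hab n hn hn).1 (fun σ τ hne => by
          rw [map_sub, map_sub, hfix σ b hbM, hfix τ b hbM] at hne ⊢
          rw [sub_sub_sub_cancel_right]
          exact (norm_sub_eq_one_of_near hp hp1 hR hlam hRc hb hab n (hlev σ) (hlev τ)).2
            fun h => hne (by rw [h])) hxM
      obtain ⟨m', hm', hmm⟩ := ih hT.2 m hm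
      exact ⟨m', hm', hxm.trans hmm⟩
  intro u hu
  obtain ⟨x, hx, hx0, hu⟩ := mem_valueGroup_iff.1 hu
  rw [levelInfty_eq_adjoin] at hx
  obtain ⟨T, hT, hxT⟩ := IntermediateField.exists_finset_of_mem_adjoin hx
  obtain ⟨m, hm, hxm⟩ := key T hT x (IntermediateField.adjoin.mono K _ _ (Set.subset_insert _ _) hxT)
  refine mem_valueGroup_iff.2 ⟨m, hm, ?_, hu.trans hxm⟩
  rw [← norm_ne_zero_iff, ← hxm]
  exact norm_ne_zero_iff.2 hx0

theorem finite_preimages {l : ℕ} (hl : l ≠ 0) (c : AlgebraicClosure K) (a : K) (n : ℕ) :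
    (preimages (unicritical l c) a n).Finite := by
  have hg0 : iteratePoly l c n - C (algebraMap K _ a) ≠ 0 := by
    intro h
    have := congrArg natDegree h
    rw [natDegree_sub_C, natDegree_iteratePoly, natDegree_zero] at this
    exact pow_ne_zero n hl this
  refine ((iteratePoly l c n - C (algebraMap K _ a)).rootSet_finite (AlgebraicClosure K)).subset
    fun z hz => ?_
  rw [mem_rootSet, coe_aeval_eq_eval]
  rw [mem_preimages_unicritical] at hz
  exact ⟨hg0, by rw [eval_sub, eval_C, eval_iteratePoly, hz, sub_self]⟩

theorem finiteDimensional_levelInfty_of_expanding [CharZero K] {l : ℕ} (hl : 2 ≤ l)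
    (hl1 : ‖(l : AlgebraicClosure K)‖ < 1) {c : AlgebraicClosure K} {a : K}
    (hlc : 1 < ‖(l : AlgebraicClosure K)‖ ^ l * ‖c‖ ^ (l - 1)) :
    FiniteDimensional K (levelInfty (unicritical l c) a) := by
  have hln : l ≠ 0 := by omega
  have hl0 : (l : AlgebraicClosure K) ≠ 0 := by
    have : CharZero (AlgebraicClosure K) := charZero_of_injective_algebraMap
      (algebraMap K (AlgebraicClosure K)).injective
    exact_mod_cast hln
  obtain ⟨N, hN⟩ := exists_krasner_approximation (a := algebraMap K _ a) hl hl0 hl1 hlc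
  -- Levels `0` to `N + 1`: level one is always included, which puts `c` into `M`.
  set S : Set (AlgebraicClosure K) := ⋃ j ∈ Finset.range (N + 2), preimages (unicritical l c) a j
    with hS
  set M := IntermediateField.adjoin K S with hM
  have hmemM : ∀ j, j < N + 2 → ∀ z, (fun z => z ^ l - c)^[j] z = algebraMap K _ a → z ∈ M := by
    intro j hj z hz
    refine IntermediateField.subset_adjoin K _ (Set.mem_biUnion (Finset.mem_range.2 hj) ?_)
    exact mem_preimages_unicritical.2 hz
  have hcM : c ∈ M := by
    obtain ⟨z, hz⟩ := exists_preimage hln c (algebraMap K _ a)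
    have hzM : z ∈ M := hmemM 1 (by omega) z hz
    rw [show c = z ^ l - algebraMap K _ a by rw [← hz]; ring]
    exact M.sub_mem (pow_mem hzM l) (M.algebraMap_mem a)
  have hall : ∀ n z, (fun z => z ^ l - c)^[n] z = algebraMap K _ a → z ∈ M := by
    intro n
    induction n with
    | zero => exact hmemM 0 (by omega)
    | succ n ih =>
      intro z hz
      rcases lt_or_ge (n + 1) (N + 2) with h | h
      · exact hmemM _ h z hz
      -- Krasner: an automorphism over `M` is isometric and fixes `b`, so it cannot move `z` farther
      -- than `|b - z|`, yet every other `l`-th power conjugate is farther away.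
      obtain ⟨b, hb, hbz⟩ := hN n (by omega) z hz
      have hbM : b ∈ M := ih b hb
      rw [Function.iterate_succ_apply] at hz
      have hfM : z ^ l - c ∈ M := ih _ hz
      rw [← InfiniteGalois.fixedField_fixingSubgroup M, IntermediateField.mem_fixedField_iff]
      intro σ hσ
      rw [IntermediateField.mem_fixingSubgroup_iff] at hσ
      by_contra hne
      have hpow : (σ z) ^ l = z ^ l := by
        have h1 := hσ _ (M.add_mem hfM hcM)
        rwa [sub_add_cancel, map_pow] at h1
      have hlt := hbz _ hpow hne
      refine hlt.not_ge ?_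
      rw [show σ z - z = (b - z) - (b - σ z) by ring]
      refine (norm_sub_le_max _ _).trans (max_le le_rfl ?_)
      rw [← norm_algEquiv σ (b - z), map_sub, hσ b hbM]
  have hle : levelInfty (unicritical l c) a ≤ M := by
    rw [levelInfty_eq_adjoin, IntermediateField.adjoin_le_iff, Set.iUnion_subset_iff]
    exact fun n z hz => hall n z (mem_preimages_unicritical.1 hz)
  have hSfin : S.Finite := Set.Finite.biUnion (Finset.finite_toSet _)
    fun j _ => finite_preimages hln c a j
  have : Finite S := hSfin
  have : FiniteDimensional K M :=
    IntermediateField.finiteDimensional_adjoin fun x _ => Algebra.IsIntegral.isIntegral x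
  exact FiniteDimensional.of_injective (IntermediateField.inclusion hle).toLinearMap
    (IntermediateField.inclusion_injective hle)

end Spectral

/-! ### Local fields, infinite degree, and translation from valuations to norms. -/

open scoped NormedField Valued in
theorem isCompact_closedBall_one_of_finite_residueField {K : Type*} [NontriviallyNormedField K]
    [IsUltrametricDist K] [CompleteSpace K] [h : IsDiscreteValuationRing (RingOfIntegers K)]
    (hk : Finite (ResidueField K)) : IsCompact (Metric.closedBall (0 : K) 1) := by
  have hd : IsDiscreteValuationRing 𝒪[K] := h
  have hk' : Finite 𝓀[K] := hk
  have hr : (Valued.v : Valuation K NNReal).RankOne :=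
    inferInstanceAs (NormedField.valuation (K := K)).RankOne
  have htb : TotallyBounded (Set.univ (α := 𝒪[K])) :=
    Valued.integer.totallyBounded_iff_finite_residueField.2 hk'
  have himg : (Subtype.val '' (Set.univ : Set 𝒪[K])) = Metric.closedBall (0 : K) 1 := by
    rw [Set.image_univ, Subtype.range_coe_subtype]
    ext x
    rw [mem_closedBall_zero_iff]
    exact Iff.rfl
  rw [isCompact_iff_totallyBounded_isComplete, ← himg]
  refine ⟨htb.image uniformContinuous_subtype_val, ?_⟩
  rw [himg]
  exact Metric.isClosed_closedBall.isComplete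

theorem properSpace_of_finite_residueField {K : Type*} [NontriviallyNormedField K]
    [IsUltrametricDist K] [CompleteSpace K] [IsDiscreteValuationRing (RingOfIntegers K)]
    (hk : Finite (ResidueField K)) : ProperSpace K := by
  have : LocallyCompactSpace K := IsCompact.locallyCompactSpace_of_mem_nhds_of_addGroup
    (isCompact_closedBall_one_of_finite_residueField hk)
    (Metric.closedBall_mem_nhds 0 zero_lt_one)
  exact .of_nontriviallyNormedField_of_weaklyLocallyCompactSpace K

section Spectral

variable {K : Type*} [NontriviallyNormedField K] [IsUltrametricDist K]

theorem charZero_of_natCast_ne_zero {p : ℕ} (hp1 : ‖(p : K)‖ < 1) (hp : p.Prime) {l : ℕ}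
    (hpl : p ∣ l) (hl : (l : AlgebraicClosure K) ≠ 0) : CharZero K := by
  have hlK : (l : K) ≠ 0 := fun h => hl (by
    rw [← map_natCast (algebraMap K (AlgebraicClosure K)), h, map_zero])
  have hpK : (p : K) ≠ 0 := by
    obtain ⟨k, rfl⟩ := hpl
    push_cast at hlK
    exact left_ne_zero_of_mul hlK
  refine charZero_of_inj_zero fun n hn => ?_
  by_contra hn0
  obtain ⟨k, m, hm, rfl⟩ := Nat.exists_eq_pow_mul_and_not_dvd hn0 p hp.ne_one
  have h1 := norm_natCast_eq_one_of_not_dvd hp hp1 hm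
  push_cast at hn
  rcases mul_eq_zero.1 hn with h | h
  · exact pow_ne_zero k hpK h
  · rw [h, norm_zero] at h1
    exact zero_ne_one h1

theorem norm_natCast_lt_one_of_charP_residueField {p : ℕ} (hchar : CharP (ResidueField K) p) :
    ‖(p : K)‖ < 1 := by
  have h0 : (algebraMap (RingOfIntegers K) (ResidueField K)) (p : RingOfIntegers K) = 0 := by
    rw [map_natCast]; exact CharP.cast_eq_zero _ p
  have hmem : (p : RingOfIntegers K) ∈ IsLocalRing.maximalIdeal (RingOfIntegers K) :=
    (IsLocalRing.residue_eq_zero_iff _).1 h0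
  have hnu : ¬ IsUnit (p : RingOfIntegers K) := (IsLocalRing.mem_maximalIdeal _).1 hmem
  refine lt_of_le_of_ne (IsUltrametricDist.norm_natCast_le_one K p) fun h => hnu ?_
  have hp0 : (p : K) ≠ 0 := by
    rw [← norm_ne_zero_iff, h]; exact one_ne_zero
  have hinv : ‖(p : K)⁻¹‖ ≤ 1 := by rw [norm_inv, h, inv_one]
  refine IsUnit.of_mul_eq_one (⟨(p : K)⁻¹, hinv⟩ : RingOfIntegers K) (Subtype.ext ?_)
  push_cast
  exact mul_inv_cancel₀ hp0

variable [CompleteSpace K]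

attribute [local instance] normedFieldAlgebraicClosure isUltrametricDist_algebraicClosure

/-- A finite extension of a local field is proper, so a ball in it is covered by finitely many balls
of radius `δ`; by pigeonhole two of the `δ`-separated tree points would share one. -/
theorem not_finiteDimensional_levelInfty_of_boundary [CharZero K]
    [IsDiscreteValuationRing (RingOfIntegers K)] (hk : Finite (ResidueField K)) {l : ℕ}
    (hl : 2 ≤ l) (hl1 : ‖(l : AlgebraicClosure K)‖ < 1) {c : AlgebraicClosure K} {a : K}
    (hlc : ‖(l : AlgebraicClosure K)‖ ^ l * ‖c‖ ^ (l - 1) = 1) :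
    ¬ FiniteDimensional K (levelInfty (unicritical l c) a) := by
  intro hfd
  have : CharZero (AlgebraicClosure K) := charZero_of_injective_algebraMap
    (algebraMap K (AlgebraicClosure K)).injective
  have hproper : ProperSpace K := properSpace_of_finite_residueField hk
  let : NormedSpace K (AlgebraicClosure K) := spectralNorm.normedSpace K (AlgebraicClosure K)
  let E : Submodule K (AlgebraicClosure K) :=
    (levelInfty (unicritical l c) a).toSubalgebra.toSubmodule
  have hE : FiniteDimensional K E := hfd
  have hpE : ProperSpace E := FiniteDimensional.proper K E
  obtain ⟨δ, hδ, R, hsep⟩ := exists_separated_points hl hl1 (algebraMap K _ a) hlc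
  obtain ⟨t, ht, hcov⟩ := Metric.totallyBounded_iff.1
    (isCompact_closedBall (0 : E) R).totallyBounded δ hδ
  obtain ⟨S, hScard, hST, hSR, hSsep⟩ := hsep (ht.toFinset.card + 1)
  have hmem : ∀ x ∈ S, ∃ y ∈ ht.toFinset, ‖x - (y : AlgebraicClosure K)‖ < δ := by
    intro x hx
    have hxE : x ∈ E := tree_subset_levelInfty l c a (hST hx)
    have hxB : (⟨x, hxE⟩ : E) ∈ Metric.closedBall (0 : E) R := by
      rw [mem_closedBall_zero_iff]
      exact (hSR x hx).le
    obtain ⟨y, hy, hxy⟩ := Set.mem_iUnion₂.1 (hcov hxB)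
    refine ⟨y, ht.mem_toFinset.2 hy, ?_⟩
    rw [Metric.mem_ball, dist_eq_norm] at hxy
    exact hxy
  choose! g hg hgδ using hmem
  have hlt : ht.toFinset.card < S.card := by
    rw [hScard]
    exact (Nat.lt_succ_self _).trans (Nat.lt_pow_self (by omega))
  obtain ⟨x, hx, y, hy, hxy, hgxy⟩ := Finset.exists_ne_map_eq_of_card_lt_of_maps_to hlt hg
  refine (hSsep x hx y hy hxy).not_gt ?_
  rw [show x - y = (x - (g x : AlgebraicClosure K)) - (y - (g x : AlgebraicClosure K)) by ring]
  exact (norm_sub_le_max _ _).trans_lt (max_lt (hgδ x hx) (by rw [hgxy]; exact hgδ y hy))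

theorem not_finiteDimensional_of_not_isFinitelyRamified
    [IsDiscreteValuationRing (RingOfIntegers K)] {E : IntermediateField K (AlgebraicClosure K)}
    (h : ¬ IsFinitelyRamified E) : ¬ FiniteDimensional K E :=
  fun _ => h (isFinitelyRamified_of_valueGroup_le (le_refl (valueGroup E)))

theorem ne_zero_of_separable {l : ℕ} (hl : 2 ≤ l) {c : AlgebraicClosure K}
    (hsep : (unicritical l c).Separable) : (l : AlgebraicClosure K) ≠ 0 ∧ c ≠ 0 := by
  have key : (l : AlgebraicClosure K) ≠ 0 := by
    intro h0
    have hder : (unicritical l c).derivative = 0 := by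
      simp [unicritical, derivative_X_pow, h0]
    rw [Polynomial.Separable, hder, isCoprime_zero_right] at hsep
    have := natDegree_eq_zero_of_isUnit hsep
    rw [unicritical, natDegree_X_pow_sub_C] at this
    omega
  refine ⟨key, ?_⟩
  rintro rfl
  have hr : (unicritical l (0 : AlgebraicClosure K)).eval 0 = 0 := by
    simp [unicritical, show l ≠ 0 by omega]
  have hd : (unicritical l (0 : AlgebraicClosure K)).derivative.eval 0 = 0 := by
    simp [unicritical, derivative_X_pow, show l - 1 ≠ 0 by omega]
  obtain ⟨u, w, h⟩ := hsep
  have := congrArg (eval 0) h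
  rw [eval_add, eval_mul, eval_mul, hr, hd] at this
  simp at this

theorem v_eq_coe (p : ℕ) {x : AlgebraicClosure K} (hx : x ≠ 0) :
    v p x = ((Real.log ‖x‖ / Real.log ‖(p : K)‖ : ℝ) : EReal) := by
  rw [v, if_neg hx, norm_eq_spectralNorm]

theorem zero_le_v_iff {p : ℕ} (hp0 : (p : K) ≠ 0) (hp1 : ‖(p : K)‖ < 1) {x : AlgebraicClosure K} :
    0 ≤ v p x ↔ ‖x‖ ≤ 1 := by
  by_cases hx : x = 0
  · simp [v, hx]
  have hq : Real.log ‖(p : K)‖ < 0 := Real.log_neg (norm_pos_iff.2 hp0) hp1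
  rw [v_eq_coe p hx, EReal.coe_nonneg, ← Real.log_nonpos_iff (norm_nonneg _)]
  constructor
  · intro h
    by_contra! h'
    exact (div_neg_of_pos_of_neg h' hq).not_ge h
  · exact fun h => div_nonneg_of_nonpos h hq.le

/-- Comparison of `v c` with the cutoff in terms of absolute values. -/
theorem v_eq_nuInfty_add {p : ℕ} {l : ℕ} (hl : 2 ≤ l)
    (hl0 : (l : AlgebraicClosure K) ≠ 0) {c : AlgebraicClosure K} (hc : c ≠ 0) :
    ∃ ν : ℝ, nuInfty K p l = (ν : EReal) ∧ v p c =
      ((ν + Real.log (‖(l : AlgebraicClosure K)‖ ^ l * ‖c‖ ^ (l - 1)) /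
        ((l - 1 : ℝ) * Real.log ‖(p : K)‖) : ℝ) : EReal) := by
  refine ⟨-((l : ℝ) / ((l : ℝ) - 1)) * (Real.log ‖(l : AlgebraicClosure K)‖ /
    Real.log ‖(p : K)‖), ?_, ?_⟩
  · rw [nuInfty, v_eq_coe p hl0, EReal.coe_mul]
  · rw [v_eq_coe p hc, Real.log_mul (pow_ne_zero _ (norm_ne_zero_iff.2 hl0))
      (pow_ne_zero _ (norm_ne_zero_iff.2 hc)), Real.log_pow, Real.log_pow,
      Nat.cast_sub (by omega), Nat.cast_one]
    have hl1 : (l : ℝ) - 1 ≠ 0 := by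
      have : (2 : ℝ) ≤ l := by exact_mod_cast hl
      linarith
    congr 1
    by_cases hq : Real.log ‖(p : K)‖ = 0
    · simp [hq]
    · field_simp
      ring

/-- `v(c) - ν_∞` is `log(λ^l)` divided by `(l - 1) log |p| < 0`, so inequalities reverse. -/
theorem v_trichotomy {p : ℕ} (hp0 : (p : K) ≠ 0) (hp1 : ‖(p : K)‖ < 1) {l : ℕ} (hl : 2 ≤ l)
    (hl0 : (l : AlgebraicClosure K) ≠ 0) {c : AlgebraicClosure K} (hc : c ≠ 0) :
    (v p c < nuInfty K p l → 1 < ‖(l : AlgebraicClosure K)‖ ^ l * ‖c‖ ^ (l - 1)) ∧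
    (v p c = nuInfty K p l → ‖(l : AlgebraicClosure K)‖ ^ l * ‖c‖ ^ (l - 1) = 1) ∧
    (nuInfty K p l < v p c → ‖(l : AlgebraicClosure K)‖ ^ l * ‖c‖ ^ (l - 1) < 1) := by
  obtain ⟨ν, hν, hv⟩ := v_eq_nuInfty_add (p := p) hl hl0 hc
  set t := ‖(l : AlgebraicClosure K)‖ ^ l * ‖c‖ ^ (l - 1)
  have ht : 0 < t := mul_pos (pow_pos (norm_pos_iff.2 hl0) _) (pow_pos (norm_pos_iff.2 hc) _)
  have hq : ((l : ℝ) - 1) * Real.log ‖(p : K)‖ < 0 := by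
    have : (2 : ℝ) ≤ l := by exact_mod_cast hl
    exact mul_neg_of_pos_of_neg (by linarith) (Real.log_neg (norm_pos_iff.2 hp0) hp1)
  rw [hν, hv, EReal.coe_lt_coe_iff, EReal.coe_lt_coe_iff, EReal.coe_eq_coe_iff]
  refine ⟨fun h => ?_, fun h => ?_, fun h => ?_⟩
  · by_contra! hle
    have := div_nonneg_of_nonpos (Real.log_nonpos ht.le hle) hq.le
    linarith
  · have h0 : Real.log t / (((l : ℝ) - 1) * Real.log ‖(p : K)‖) = 0 := by linarith
    rcases (div_eq_zero_iff.1 h0).resolve_right hq.ne with h1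
    exact Real.eq_one_of_pos_of_log_eq_zero ht h1
  · by_contra! hle
    have := div_nonpos_of_nonneg_of_nonpos (Real.log_nonneg hle) hq.le
    linarith

theorem nearFixedPoint_iff {p : ℕ} (hp0 : (p : K) ≠ 0) (hp1 : ‖(p : K)‖ < 1) {l : ℕ}
    {c : AlgebraicClosure K} {a : K} : NearFixedPoint p (unicritical l c) a ↔
      ∃ b : AlgebraicClosure K, b ^ l - c = b ∧ ‖algebraMap K _ a - b‖ ≤ 1 := by
  simp only [NearFixedPoint, zero_le_v_iff hp0 hp1]
  simp [unicritical]

end Spectral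

end Arboreal

/-! ### Assembly of the three cases. -/

section

attribute [local instance] Arboreal.normedFieldAlgebraicClosure
  Arboreal.isUltrametricDist_algebraicClosure

theorem Arboreal.boundary_case {K : Type*} [NontriviallyNormedField K] [IsUltrametricDist K]
    [CompleteSpace K] [IsDiscreteValuationRing (Arboreal.RingOfIntegers K)] [CharZero K]
    {p : ℕ} (hp : p.Prime) (hp1 : ‖(p : K)‖ < 1)
    {l : ℕ} (hl : 2 ≤ l) (hpl : p ∣ l) {c : AlgebraicClosure K} {a : K}
    (hlc : ‖(l : AlgebraicClosure K)‖ ^ l * ‖c‖ ^ (l - 1) = 1) :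
    (¬ (l = p ∧ NearFixedPoint p (unicritical l c) a) →
      IsInfinitelyWildlyRamified p (levelInfty (unicritical l c) a)) ∧
    (l = p ∧ NearFixedPoint p (unicritical l c) a →
      IsFinitelyRamified (levelInfty (unicritical l c) a)) := by
  have : CharZero (AlgebraicClosure K) := charZero_of_injective_algebraMap
    (algebraMap K (AlgebraicClosure K)).injective
  have hpK : (p : K) ≠ 0 := by exact_mod_cast hp.ne_zero
  have hpL : ‖(p : AlgebraicClosure K)‖ < 1 := by
    rw [← map_natCast (algebraMap K (AlgebraicClosure K)), norm_algebraMap_algebraicClosure]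
    exact hp1
  rw [nearFixedPoint_iff hpK hp1]
  constructor
  · intro hnot
    refine HasWildSeq.isInfinitelyWildlyRamified hp ?_
    by_cases hlp : l = p
    · subst hlp
      exact hasWildSeq_of_boundary_prime hp hpL hlc (fun h => hnot ⟨rfl, h⟩)
        (tree_subset_levelInfty l c a)
    · exact hasWildSeq_of_boundary_of_ne hp hpL hl hpl hlp hlc (tree_subset_levelInfty l c a)
  · rintro ⟨rfl, b, hb, hab⟩
    have : FiniteDimensional K (IntermediateField.adjoin K {b}) :=
      IntermediateField.adjoin.finiteDimensional (Algebra.IsIntegral.isIntegral b)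
    exact isFinitelyRamified_of_valueGroup_le
      (valueGroup_levelInfty_le_of_near hp hpL hlc hb hab)

theorem mainTheorem1 {K : Type*} [NontriviallyNormedField K] [IsUltrametricDist K]
    [CompleteSpace K] [IsDiscreteValuationRing (Arboreal.RingOfIntegers K)]
    (p : ℕ) (hp : p.Prime) (hchar : CharP (Arboreal.ResidueField K) p)
    (l : ℕ) (hl : 2 ≤ l) (hpl : p ∣ l)
    (c : AlgebraicClosure K) (hsep : (Arboreal.unicritical l c).Separable) (a : K) :
    (Arboreal.v p c < Arboreal.nuInfty K p l →
      FiniteDimensional K (Arboreal.levelInfty (Arboreal.unicritical l c) a)) ∧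
    (Arboreal.v p c = Arboreal.nuInfty K p l →
      ((Finite (Arboreal.ResidueField K) ∨
          ¬ (l = p ∧ Arboreal.NearFixedPoint p (Arboreal.unicritical l c) a)) →
        ¬ FiniteDimensional K (Arboreal.levelInfty (Arboreal.unicritical l c) a)) ∧
      (Arboreal.IsFinitelyRamified (Arboreal.levelInfty (Arboreal.unicritical l c) a) ↔
        l = p ∧ Arboreal.NearFixedPoint p (Arboreal.unicritical l c) a)) ∧
    (Arboreal.nuInfty K p l < Arboreal.v p c →
      Arboreal.IsInfinitelyWildlyRamified p
        (Arboreal.levelInfty (Arboreal.unicritical l c) a)) := by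
  have hp1 := Arboreal.norm_natCast_lt_one_of_charP_residueField hchar
  obtain ⟨hl0, hc0⟩ := Arboreal.ne_zero_of_separable hl hsep
  -- Separability gives `l ≠ 0` in the field, hence `p ≠ 0`, which excludes positive characteristic.
  have : CharZero K := Arboreal.charZero_of_natCast_ne_zero hp1 hp hpl hl0
  have hpK : (p : K) ≠ 0 := by exact_mod_cast hp.ne_zero
  have hpL : ‖(p : AlgebraicClosure K)‖ < 1 := by
    rw [← map_natCast (algebraMap K (AlgebraicClosure K)),
      Arboreal.norm_algebraMap_algebraicClosure]
    exact hp1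
  have hl1 : ‖(l : AlgebraicClosure K)‖ < 1 := Arboreal.norm_lt_one_of_dvd hpL hpl
  obtain ⟨hlt, heq, hgt⟩ := Arboreal.v_trichotomy hpK hp1 hl hl0 hc0
  refine ⟨fun h => Arboreal.finiteDimensional_levelInfty_of_expanding hl hl1 (hlt h),
    fun h => ?_, fun h => Arboreal.HasWildSeq.isInfinitelyWildlyRamified hp ?_⟩
  · obtain ⟨hwild, hfin⟩ := Arboreal.boundary_case (a := a) hp hp1 hl hpl (heq h)
    refine ⟨?_, fun hram => ?_, hfin⟩
    · rintro (hk | hnot)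
      · exact Arboreal.not_finiteDimensional_levelInfty_of_boundary hk hl hl1 (heq h)
      · exact Arboreal.not_finiteDimensional_of_not_isFinitelyRamified
          ((hwild hnot).not_isFinitelyRamified hp)
    · by_contra hnot
      exact (hwild hnot).not_isFinitelyRamified hp hram
  · rcases lt_or_ge 1 ‖c‖ with hc | hc
    · exact Arboreal.hasWildSeq_of_one_lt_norm hp hpL hl hl0 hpl hc (hgt h)
        (Arboreal.tree_subset_levelInfty l c a)
    · exact Arboreal.hasWildSeq_of_norm_le_one hp hpL hl hl0 hpl hc0 hc
        (Arboreal.tree_subset_levelInfty l c a)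

end
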